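/- Let $k\ge 0$ be an integer. For a compact oriented smooth manifold $M$ without boundary (Hausdorff, not necessarily connected) of dimension $4k$, let $H^{2k}(M)$ be its de Rham cohomology in degree $2k$ (closed smooth $2k$-forms modulo exact ones), a finite-dimensional real vector space, and let $$Q_M([\omega_1],[\omega_2])=\int_M \omega_1\wedge\omega_2$$ be its signature form on $H^{2k}(M)$; the right-hand side does not depend on the choice of the closed representatives $\omega_1,\omega_2$ of the two classes. The signature $\sigma(M)$ is the number of positive eigenvalues minus the number of negative eigenvalues, counted with multiplicity, of the matrix of $Q_M$ in a basis of $H^{2k}(M)$; it does not depend on the basis. Theorem and Corollary. Let $M$ and $N$ be compact oriented smooth manifolds without boundary of dimension $4k$, and let $\varphi\colon M\to N$ be an orientation-preserving ($C^\infty$) diffeomorphism, with induced map $\varphi^*\colon H^{2k}(N)\to H^{2k}(M)$, $\varphi^*[\omega]=[\varphi^*\omega]$. Then $$Q_M(\varphi^*a,\varphi^*b)=Q_N(a,b)\qquad\text{for all } a,b\in H^{2k}(N),$$ and consequently $\sigma(M)=\sigma(N)$. -/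

import Mathlib

open scoped Manifold ContDiff Topology

noncomputable section

namespace DeRham

section Basic

variable {m n p : ℕ}
  {M : Type*} [TopologicalSpace M] [ChartedSpace (EuclideanSpace ℝ (Fin m)) M]
  {N : Type*} [TopologicalSpace N] [ChartedSpace (EuclideanSpace ℝ (Fin n)) N]

/-- Not necessarily smooth `p`-forms on the `n`-dimensional manifold `N`: a choice, for every point
`x`, of an alternating `p`-linear form on the tangent space at `x`. -/
abbrev FormField (n p : ℕ) (N : Type*) [TopologicalSpace N]
    [ChartedSpace (EuclideanSpace ℝ (Fin n)) N] : Type _ :=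
  ∀ x : N, TangentSpace (𝓡 n) x [⋀^Fin p]→L[ℝ] ℝ

/-- The coordinate expression of a form in the chart around `c`: its pullback along the inverse of
the chart, a form on (the target of the chart in) `ℝⁿ`. -/
def localRep (α : FormField n p N) (c : N) (y : EuclideanSpace ℝ (Fin n)) :
    EuclideanSpace ℝ (Fin n) [⋀^Fin p]→L[ℝ] ℝ :=
  (α ((extChartAt (𝓡 n) c).symm y)).compContinuousLinearMap
    (mfderiv 𝓘(ℝ, EuclideanSpace ℝ (Fin n)) (𝓡 n) (extChartAt (𝓡 n) c).symm y)

/-- The pullback `f^*α`, `(f^*α)_x (v₁, …, v_p) = α_{f x} (df_x v₁, …, df_x v_p)`. -/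
def pullbackField (f : M → N) (α : FormField n p N) : FormField m p M :=
  fun x => (α (f x)).compContinuousLinearMap (mfderiv (𝓡 m) (𝓡 n) f x)

/-- The exterior derivative: at `x`, it is the Euclidean exterior derivative of the coordinate
expression in the chart around `x`, carried back to the tangent space at `x`. By
`localRep_extDerivField` below, for a smooth form this is the Euclidean exterior derivative in every
chart. -/
def extDerivField (α : FormField n p N) : FormField n (p + 1) N :=
  fun x => (extDeriv (localRep α x) (extChartAt (𝓡 n) x x)).compContinuousLinearMap
    (mfderiv (𝓡 n) 𝓘(ℝ, EuclideanSpace ℝ (Fin n)) (extChartAt (𝓡 n) x) x)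

theorem contDiffOn_alternating_iff {E F : Type*} [NormedAddCommGroup E] [NormedSpace ℝ E]
    [FiniteDimensional ℝ E] [NormedAddCommGroup F] [NormedSpace ℝ F]
    {s : Set F} {f : F → E [⋀^Fin p]→L[ℝ] ℝ} :
    ContDiffOn ℝ ∞ f s ↔ ∀ v : Fin p → E, ContDiffOn ℝ ∞ (fun y => f y v) s := by
  constructor
  · intro h v
    exact (ContinuousAlternatingMap.apply ℝ E ℝ v).contDiff.comp_contDiffOn h
  · intro h
    let b := Module.finBasis ℝ E
    let T : (E [⋀^Fin p]→L[ℝ] ℝ) →ₗ[ℝ] ((Fin p → Fin (Module.finrank ℝ E)) → ℝ) :=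
      { toFun := fun a J => a (fun i => b (J i))
        map_add' := fun _ _ => rfl
        map_smul' := fun _ _ => rfl }
    have hT : LinearMap.ker T = ⊥ := by
      rw [LinearMap.ker_eq_bot]
      intro a a' haa
      have : a.toAlternatingMap = a'.toAlternatingMap :=
        AlternatingMap.coe_multilinearMap_injective
          (Module.Basis.ext_multilinear (fun _ => b) (fun J => congrFun haa J))
      exact ContinuousAlternatingMap.toAlternatingMap_injective this
    obtain ⟨L, hL⟩ := T.exists_leftInverse_of_injective hT
    have hf : f = fun y => LinearMap.toContinuousLinearMap L (fun J => f y (fun i => b (J i))) := by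
      funext y
      exact (LinearMap.congr_fun hL (f y)).symm
    rw [hf]
    exact (LinearMap.toContinuousLinearMap L).contDiff.comp_contDiffOn
      (contDiffOn_pi.2 fun J => h _)

theorem contDiffOn_alternating_apply {E F : Type*} [NormedAddCommGroup E] [NormedSpace ℝ E]
    [NormedAddCommGroup F] [NormedSpace ℝ F]
    {s : Set F} {f : F → E [⋀^Fin p]→L[ℝ] ℝ} {w : Fin p → F → E}
    (hf : ContDiffOn ℝ ∞ f s) (hw : ∀ i, ContDiffOn ℝ ∞ (w i) s) :
    ContDiffOn ℝ ∞ (fun y => f y (fun i => w i y)) s := by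
  let B := ContinuousAlternatingMap.toContinuousMultilinearMapCLM (𝕜 := ℝ) (E := E) (F := ℝ)
    (ι := Fin p) ℝ
  have hB : ContDiff ℝ ∞ (fun q : (E [⋀^Fin p]→L[ℝ] ℝ) × (Fin p → E) => B q.1 q.2) :=
    contDiff_iff_contDiffAt.2 fun q => B.analyticAt_uncurry_of_multilinear.contDiffAt
  exact hB.comp_contDiffOn (hf.prodMk (contDiffOn_pi.2 hw))

/-- The map `f` read in the charts around `c` and `c'`. -/
def coordMap (m n : ℕ) {M : Type*} [TopologicalSpace M] [ChartedSpace (EuclideanSpace ℝ (Fin m)) M] {N : Type*} [TopologicalSpace N] [ChartedSpace (EuclideanSpace ℝ (Fin n)) N] (f : M → N) (c : M) (c' : N) :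
    EuclideanSpace ℝ (Fin m) → EuclideanSpace ℝ (Fin n) :=
  extChartAt (𝓡 n) c' ∘ f ∘ (extChartAt (𝓡 m) c).symm

/-- The part of the target of the chart around `c` where `coordMap f c c'` is meaningful. -/
def coordDomain (m n : ℕ) {M : Type*} [TopologicalSpace M] [ChartedSpace (EuclideanSpace ℝ (Fin m)) M] {N : Type*} [TopologicalSpace N] [ChartedSpace (EuclideanSpace ℝ (Fin n)) N] (f : M → N) (c : M) (c' : N) : Set (EuclideanSpace ℝ (Fin m)) :=
  (extChartAt (𝓡 m) c).target ∩ (extChartAt (𝓡 m) c).symm ⁻¹' (f ⁻¹' (extChartAt (𝓡 n) c').source)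

theorem isOpen_coordDomain {f : M → N} (hf : Continuous f) (c : M) (c' : N) :
    IsOpen (coordDomain m n f c c') :=
  (continuousOn_extChartAt_symm c).isOpen_inter_preimage (isOpen_extChartAt_target c)
    ((isOpen_extChartAt_source c').preimage hf)

theorem two_le_infty : (2 : WithTop ℕ∞) ≤ ∞ := by
  exact WithTop.coe_le_coe.2 (le_top : (2 : ℕ∞) ≤ ⊤)

theorem pullbackField_id (α : FormField n p N) : pullbackField (m := n) (id : N → N) α = α := by
  funext x
  ext v
  simp only [pullbackField, ContinuousAlternatingMap.compContinuousLinearMap_apply, mfderiv_id]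
  rfl

variable [IsManifold (𝓡 m) ∞ M] [IsManifold (𝓡 n) ∞ N]

theorem mdifferentiableAt_symm (c : N) {y : EuclideanSpace ℝ (Fin n)}
    (hy : y ∈ (extChartAt (𝓡 n) c).target) :
    MDifferentiableAt 𝓘(ℝ, EuclideanSpace ℝ (Fin n)) (𝓡 n) (extChartAt (𝓡 n) c).symm y := by
  have : IsManifold (𝓡 n) 1 N := IsManifold.of_le (n := ∞) (by simp)
  have h := mdifferentiableWithinAt_extChartAt_symm (I := 𝓡 n) hy
  rwa [ModelWithCorners.range_eq_univ, mdifferentiableWithinAt_univ] at h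

theorem contDiffOn_coordMap {f : M → N} (hf : ContMDiff (𝓡 m) (𝓡 n) ∞ f) (c : M) (c' : N) :
    ContDiffOn ℝ ∞ (coordMap m n f c c') (coordDomain m n f c c') :=
  (contMDiff_iff.1 hf).2 c c'

theorem localRep_pullbackField {f : M → N} (hf : ContMDiff (𝓡 m) (𝓡 n) ∞ f)
    (α : FormField n p N) (c : M) (c' : N) {y : EuclideanSpace ℝ (Fin m)}
    (hy : y ∈ coordDomain m n f c c') :
    localRep (pullbackField f α) c y =
      (localRep α c' (coordMap m n f c c' y)).compContinuousLinearMap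
        (fderiv ℝ (coordMap m n f c c') y) := by
  obtain ⟨hy1, hy2⟩ := hy
  have hz : (extChartAt (𝓡 n) c').symm (coordMap m n f c c' y) = f ((extChartAt (𝓡 m) c).symm y) :=
    (extChartAt (𝓡 n) c').left_inv hy2
  have hg : DifferentiableAt ℝ (coordMap m n f c c') y :=
    ((contDiffOn_coordMap hf c c').contDiffAt
      ((isOpen_coordDomain hf.continuous c c').mem_nhds ⟨hy1, hy2⟩)).differentiableAt (by simp)
  have hgt : coordMap m n f c c' y ∈ (extChartAt (𝓡 n) c').target :=
    (extChartAt (𝓡 n) c').map_source hy2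
  have h1 : mfderiv 𝓘(ℝ, EuclideanSpace ℝ (Fin m)) (𝓡 n)
      ((extChartAt (𝓡 n) c').symm ∘ coordMap m n f c c') y =
      (mfderiv 𝓘(ℝ, EuclideanSpace ℝ (Fin n)) (𝓡 n) (extChartAt (𝓡 n) c').symm
        (coordMap m n f c c' y)).comp (fderiv ℝ (coordMap m n f c c') y) := by
    rw [mfderiv_comp y (mdifferentiableAt_symm c' hgt) hg.mdifferentiableAt, mfderiv_eq_fderiv]
    rfl
  have h2 : mfderiv 𝓘(ℝ, EuclideanSpace ℝ (Fin m)) (𝓡 n)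
      (f ∘ (extChartAt (𝓡 m) c).symm) y =
      (mfderiv (𝓡 m) (𝓡 n) f ((extChartAt (𝓡 m) c).symm y)).comp
        (mfderiv 𝓘(ℝ, EuclideanSpace ℝ (Fin m)) (𝓡 m) (extChartAt (𝓡 m) c).symm y) :=
    mfderiv_comp y ((hf _).mdifferentiableAt (by simp)) (mdifferentiableAt_symm c hy1)
  have h3 : (extChartAt (𝓡 n) c').symm ∘ coordMap m n f c c' =ᶠ[𝓝 y]
      f ∘ (extChartAt (𝓡 m) c).symm := by
    filter_upwards [(isOpen_coordDomain hf.continuous c c').mem_nhds ⟨hy1, hy2⟩] with w hw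
    exact (extChartAt (𝓡 n) c').left_inv hw.2
  have h4 := h3.mfderiv_eq (I := 𝓘(ℝ, EuclideanSpace ℝ (Fin m))) (I' := 𝓡 n)
  have h5 : ∀ (z z' : N) (_ : z = z') (A : EuclideanSpace ℝ (Fin m) →L[ℝ] EuclideanSpace ℝ (Fin n)),
      (show EuclideanSpace ℝ (Fin n) [⋀^Fin p]→L[ℝ] ℝ from α z).compContinuousLinearMap A =
      (show EuclideanSpace ℝ (Fin n) [⋀^Fin p]→L[ℝ] ℝ from α z').compContinuousLinearMap A := by
    rintro z _ rfl A
    rfl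
  have h6 := h5 _ _ hz (mfderiv 𝓘(ℝ, EuclideanSpace ℝ (Fin m)) (𝓡 n)
      (f ∘ (extChartAt (𝓡 m) c).symm) y)
  ext v
  have h8 := DFunLike.congr_fun h6 v
  rw [h2] at h4 h8
  have h7 : ∀ u, mfderiv 𝓘(ℝ, EuclideanSpace ℝ (Fin n)) (𝓡 n) (extChartAt (𝓡 n) c').symm
        (coordMap m n f c c' y) (fderiv ℝ (coordMap m n f c c') y u) =
      mfderiv (𝓡 m) (𝓡 n) f ((extChartAt (𝓡 m) c).symm y)
        (mfderiv 𝓘(ℝ, EuclideanSpace ℝ (Fin m)) (𝓡 m) (extChartAt (𝓡 m) c).symm y u) :=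
    fun u => DFunLike.congr_fun (h1.symm.trans h4) u
  refine Eq.trans h8.symm ?_
  refine congrArg (show EuclideanSpace ℝ (Fin n) [⋀^Fin p]→L[ℝ] ℝ from
    α ((extChartAt (𝓡 n) c').symm (coordMap m n f c c' y))) ?_
  funext i
  exact (h7 (v i)).symm

theorem localRep_change (α : FormField n p N) (c c' : N) {y : EuclideanSpace ℝ (Fin n)}
    (hy : y ∈ coordDomain n n (id : N → N) c c') :
    localRep α c y =
      (localRep α c' (coordMap n n id c c' y)).compContinuousLinearMap
        (fderiv ℝ (coordMap n n (id : N → N) c c') y) := by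
  have h := localRep_pullbackField contMDiff_id α c c' hy
  rwa [pullbackField_id] at h

/-- A form is smooth if all its coordinate expressions are smooth. -/
def IsSmoothField (α : FormField n p N) : Prop :=
  ∀ c : N, ContDiffOn ℝ ∞ (localRep α c) (extChartAt (𝓡 n) c).target

theorem contDiffOn_pullback_aux {s : Set (EuclideanSpace ℝ (Fin m))} (hs : IsOpen s)
    {t : Set (EuclideanSpace ℝ (Fin n))}
    {a : EuclideanSpace ℝ (Fin n) → EuclideanSpace ℝ (Fin n) [⋀^Fin p]→L[ℝ] ℝ}
    {g : EuclideanSpace ℝ (Fin m) → EuclideanSpace ℝ (Fin n)}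
    (ha : ContDiffOn ℝ ∞ a t) (hg : ContDiffOn ℝ ∞ g s) (hst : Set.MapsTo g s t) :
    ContDiffOn ℝ ∞ (fun y => (a (g y)).compContinuousLinearMap (fderiv ℝ g y)) s := by
  rw [contDiffOn_alternating_iff]
  intro v
  exact contDiffOn_alternating_apply (f := fun y => a (g y))
    (w := fun i y => fderiv ℝ g y (v i)) (ha.comp hg hst) fun i =>
    (hg.fderiv_of_isOpen (m := ∞) hs (by simp)).clm_apply contDiffOn_const

theorem IsSmoothField.pullback {f : M → N} (hf : ContMDiff (𝓡 m) (𝓡 n) ∞ f)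
    {α : FormField n p N} (hα : IsSmoothField α) :
    IsSmoothField (pullbackField (m := m) f α) := by
  intro c
  refine contDiffOn_of_locally_contDiffOn fun y hy => ?_
  let c' : N := f ((extChartAt (𝓡 m) c).symm y)
  have ho := isOpen_coordDomain (m := m) (n := n) hf.continuous c c'
  refine ⟨coordDomain m n f c c', ho, ⟨hy, mem_extChartAt_source c'⟩, ?_⟩
  have h1 := contDiffOn_pullback_aux ho (hα c') (contDiffOn_coordMap hf c c')
    (fun w hw => (extChartAt (𝓡 n) c').map_source hw.2)
  exact (h1.mono Set.inter_subset_right).congr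
    fun w hw => localRep_pullbackField hf α c c' hw.2

/-- In every chart, the exterior derivative is the Euclidean one. -/
theorem localRep_extDerivField {α : FormField n p N} (hα : IsSmoothField α) (c : N)
    {y : EuclideanSpace ℝ (Fin n)} (hy : y ∈ (extChartAt (𝓡 n) c).target) :
    localRep (extDerivField α) c y = extDeriv (localRep α c) y := by
  let x : N := (extChartAt (𝓡 n) c).symm y
  have hx : y ∈ coordDomain n n (id : N → N) c x := ⟨hy, mem_extChartAt_source x⟩
  have ho := isOpen_coordDomain (m := n) (n := n) (f := (id : N → N)) continuous_id c x
  have h1 : localRep α c =ᶠ[𝓝 y] fun w =>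
      (localRep α x (coordMap n n id c x w)).compContinuousLinearMap
        (fderiv ℝ (coordMap n n (id : N → N) c x) w) := by
    filter_upwards [ho.mem_nhds hx] with w hw using localRep_change α c x hw
  have hg : ContDiffAt ℝ ∞ (coordMap n n (id : N → N) c x) y :=
    (contDiffOn_coordMap contMDiff_id c x).contDiffAt (ho.mem_nhds hx)
  have hd : DifferentiableAt ℝ (localRep α x) (coordMap n n (id : N → N) c x y) :=
    ((hα x).contDiffAt (extChartAt_target_mem_nhds x)).differentiableAt (by simp)
  rw [h1.extDeriv_eq, extDeriv_pullback hd hg (by simpa using two_le_infty)]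
  have h3 : mfderiv 𝓘(ℝ, EuclideanSpace ℝ (Fin n)) 𝓘(ℝ, EuclideanSpace ℝ (Fin n))
      (extChartAt (𝓡 n) x ∘ (extChartAt (𝓡 n) c).symm) y =
      (mfderiv (𝓡 n) 𝓘(ℝ, EuclideanSpace ℝ (Fin n)) (extChartAt (𝓡 n) x) x).comp
        (mfderiv 𝓘(ℝ, EuclideanSpace ℝ (Fin n)) (𝓡 n) (extChartAt (𝓡 n) c).symm y) := by
    have : IsManifold (𝓡 n) 1 N := IsManifold.of_le (n := ∞) (by simp)
    exact mfderiv_comp y (mdifferentiableAt_extChartAt (mem_chart_source _ x))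
      (mdifferentiableAt_symm c hy)
  rw [mfderiv_eq_fderiv] at h3
  ext v
  refine congrArg (extDeriv (localRep α x) (extChartAt (𝓡 n) x x)) ?_
  funext i
  exact (DFunLike.congr_fun h3 (v i)).symm

theorem IsSmoothField.extDeriv {α : FormField n p N} (hα : IsSmoothField α) :
    IsSmoothField (extDerivField α) := by
  intro c
  have h : ContDiffOn ℝ ∞ (_root_.extDeriv (localRep α c)) (extChartAt (𝓡 n) c).target :=
    (ContinuousAlternatingMap.alternatizeUncurryFinCLM ℝ (EuclideanSpace ℝ (Fin n)) ℝ).contDiff.comp_contDiffOn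
      ((hα c).fderiv_of_isOpen (isOpen_extChartAt_target c) (by simp))
  exact h.congr fun y hy => localRep_extDerivField hα c hy

theorem apply_eq_localRep (α : FormField n p N) (c : N) {x : N}
    (hx : x ∈ (extChartAt (𝓡 n) c).source) (v : Fin p → TangentSpace (𝓡 n) x) :
    α x v = localRep α c (extChartAt (𝓡 n) c x) (fun i =>
      mfderiv (𝓡 n) 𝓘(ℝ, EuclideanSpace ℝ (Fin n)) (extChartAt (𝓡 n) c) x (v i)) := by
  have : IsManifold (𝓡 n) 1 N := IsManifold.of_le (n := ∞) (by simp)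
  have h := mfderivWithin_extChartAt_symm_comp_mfderiv_extChartAt' (I := 𝓡 n) hx
  rw [ModelWithCorners.range_eq_univ, mfderivWithin_univ] at h
  have h5 : ∀ (z z' : N) (_ : z = z') (w : Fin p → EuclideanSpace ℝ (Fin n)),
      (show EuclideanSpace ℝ (Fin n) [⋀^Fin p]→L[ℝ] ℝ from α z) w =
      (show EuclideanSpace ℝ (Fin n) [⋀^Fin p]→L[ℝ] ℝ from α z') w := by
    rintro z _ rfl w
    rfl
  refine Eq.trans (h5 _ _ ((extChartAt (𝓡 n) c).left_inv hx).symm v) ?_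
  refine congrArg (show EuclideanSpace ℝ (Fin n) [⋀^Fin p]→L[ℝ] ℝ from
    α ((extChartAt (𝓡 n) c).symm (extChartAt (𝓡 n) c x))) ?_
  funext i
  exact (DFunLike.congr_fun h (v i)).symm

theorem eq_of_localRep_eq {α β : FormField n p N}
    (h : ∀ c : N, ∀ y ∈ (extChartAt (𝓡 n) c).target, localRep α c y = localRep β c y) :
    α = β := by
  funext x
  ext v
  rw [apply_eq_localRep α x (mem_extChartAt_source x), apply_eq_localRep β x
    (mem_extChartAt_source x), h x _ (mem_extChartAt_target x)]

/-- Exterior derivative commutes with pullback. -/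
theorem extDerivField_pullbackField {f : M → N} (hf : ContMDiff (𝓡 m) (𝓡 n) ∞ f)
    {α : FormField n p N} (hα : IsSmoothField α) :
    extDerivField (pullbackField (m := m) f α) = pullbackField f (extDerivField α) := by
  refine eq_of_localRep_eq fun c y hy => ?_
  let c' : N := f ((extChartAt (𝓡 m) c).symm y)
  have hyd : y ∈ coordDomain m n f c c' := ⟨hy, mem_extChartAt_source c'⟩
  have ho := isOpen_coordDomain (m := m) (n := n) hf.continuous c c'
  have hgt : coordMap m n f c c' y ∈ (extChartAt (𝓡 n) c').target :=
    (extChartAt (𝓡 n) c').map_source hyd.2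
  have h1 : localRep (pullbackField (m := m) f α) c =ᶠ[𝓝 y] fun w =>
      (localRep α c' (coordMap m n f c c' w)).compContinuousLinearMap
        (fderiv ℝ (coordMap m n f c c') w) := by
    filter_upwards [ho.mem_nhds hyd] with w hw using localRep_pullbackField hf α c c' hw
  have hg : ContDiffAt ℝ ∞ (coordMap m n f c c') y :=
    (contDiffOn_coordMap hf c c').contDiffAt (ho.mem_nhds hyd)
  have hd : DifferentiableAt ℝ (localRep α c') (coordMap m n f c c' y) :=
    ((hα c').contDiffAt ((isOpen_extChartAt_target c').mem_nhds hgt)).differentiableAt (by simp)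
  rw [localRep_extDerivField (hα.pullback hf) c hy, h1.extDeriv_eq,
    extDeriv_pullback hd hg (by simpa using two_le_infty),
    localRep_pullbackField hf _ c c' hyd, localRep_extDerivField hα c' hgt]

end Basic

section Forms

variable (n p : ℕ) (M : Type*) [TopologicalSpace M] [ChartedSpace (EuclideanSpace ℝ (Fin n)) M]

/-- The space of smooth forms, as a subspace of the space of all fields of forms. -/
def smoothForms : Submodule ℝ (FormField n p M) where
  carrier := {α | IsSmoothField α}
  zero_mem' := fun _ => contDiffOn_const (c := 0)
  add_mem' := fun ha hb c => (ha c).add (hb c)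
  smul_mem' := fun r _ ha c => ((contDiffOn_const (c := r)).smul (ha c)).congr fun _ _ => rfl

/-- `Ω^p(M)`: smooth `p`-forms on the `n`-dimensional manifold `M`. -/
def Form : Type _ := ↥(smoothForms n p M)

instance : AddCommGroup (Form n p M) := inferInstanceAs (AddCommGroup ↥(smoothForms n p M))

instance : Module ℝ (Form n p M) := inferInstanceAs (Module ℝ ↥(smoothForms n p M))

variable {n p M}

theorem Form.smooth (α : Form n p M) : IsSmoothField α.1 := α.2

variable [IsManifold (𝓡 n) ∞ M]

/-- The exterior derivative `d : Ω^p(M) → Ω^{p+1}(M)`. -/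
def extD : Form n p M →ₗ[ℝ] Form n (p + 1) M where
  toFun α := ⟨extDerivField α.1, α.smooth.extDeriv⟩
  map_add' α β := by
    refine Subtype.ext (eq_of_localRep_eq fun c y hy => ?_)
    have hn := (isOpen_extChartAt_target (I := 𝓡 n) c).mem_nhds hy
    refine (localRep_extDerivField (α + β).smooth c hy).trans ?_
    refine (extDeriv_add (((α.smooth c).contDiffAt hn).differentiableAt (by simp))
      (((β.smooth c).contDiffAt hn).differentiableAt (by simp))).trans ?_
    exact (congrArg₂ (· + ·) (localRep_extDerivField α.smooth c hy)
      (localRep_extDerivField β.smooth c hy)).symm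
  map_smul' r α := by
    refine Subtype.ext (eq_of_localRep_eq fun c y hy => ?_)
    refine (localRep_extDerivField (r • α).smooth c hy).trans ?_
    refine (extDeriv_smul r (localRep α.1 c)).trans ?_
    exact (congrArg (r • ·) (localRep_extDerivField α.smooth c hy)).symm


theorem extD_extD (α : Form n p M) : extD (extD α) = 0 := by
  refine Subtype.ext (eq_of_localRep_eq fun c y hy => ?_)
  have hn := (isOpen_extChartAt_target (I := 𝓡 n) c).mem_nhds hy
  refine (localRep_extDerivField (extD α).smooth c hy).trans ?_
  have h1 : localRep (extD α).1 c =ᶠ[𝓝 y] extDeriv (localRep α.1 c) := by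
    filter_upwards [hn] with w hw using localRep_extDerivField α.smooth c hw
  exact h1.extDeriv_eq.trans (extDeriv_extDeriv_apply ((α.smooth c).contDiffAt hn)
    (by simpa using two_le_infty))

variable {N : Type*} [TopologicalSpace N] {m : ℕ} [ChartedSpace (EuclideanSpace ℝ (Fin m)) N]
  [IsManifold (𝓡 m) ∞ N]

/-- The pullback `f^* : Ω^p(N) → Ω^p(M)` along a smooth map `f : M → N`. -/
def pullback (f : M → N) (hf : ContMDiff (𝓡 n) (𝓡 m) ∞ f) : Form m p N →ₗ[ℝ] Form n p M where
  toFun α := ⟨pullbackField f α.1, α.smooth.pullback hf⟩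
  map_add' _ _ := rfl
  map_smul' _ _ := rfl

theorem extD_pullback {f : M → N} (hf : ContMDiff (𝓡 n) (𝓡 m) ∞ f) (α : Form m p N) :
    extD (pullback f hf α) = pullback f hf (extD α) :=
  Subtype.ext (extDerivField_pullbackField hf α.smooth)

variable (n p M) in
/-- Closed `p`-forms: the kernel of `d`. -/
def closedForms : Submodule ℝ (Form n p M) := LinearMap.ker extD

variable (n M) in
/-- Exact `p`-forms: the image of `d`; in degree `0`, only the form `0`. -/
def exactForms : (p : ℕ) → Submodule ℝ (Form n p M)
  | 0 => ⊥
  | _ + 1 => LinearMap.range extD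

variable (n p M) in
/-- The de Rham cohomology `H^p(M)`: closed forms modulo exact forms. -/
abbrev Cohomology : Type _ :=
  closedForms n p M ⧸ (exactForms n M p).submoduleOf (closedForms n p M)

theorem pullback_mem_closedForms {f : M → N} (hf : ContMDiff (𝓡 n) (𝓡 m) ∞ f)
    {α : Form m p N} (hα : α ∈ closedForms m p N) :
    pullback f hf α ∈ closedForms n p M := by
  have h : extD α = 0 := hα
  show extD (pullback f hf α) = 0
  rw [extD_pullback, h, map_zero]

theorem pullback_mem_exactForms {f : M → N} (hf : ContMDiff (𝓡 n) (𝓡 m) ∞ f)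
    {α : Form m p N} (hα : α ∈ exactForms m N p) :
    pullback f hf α ∈ exactForms n M p := by
  cases p with
  | zero =>
    have h : α = 0 := hα
    rw [h, map_zero]
    exact Submodule.zero_mem _
  | succ q =>
    obtain ⟨τ, rfl⟩ := hα
    exact ⟨pullback f hf τ, extD_pullback hf τ⟩

/-- The pullback of closed forms. -/
def closedPullback (f : M → N) (hf : ContMDiff (𝓡 n) (𝓡 m) ∞ f) :
    closedForms m p N →ₗ[ℝ] closedForms n p M :=
  (pullback f hf).restrict fun _ => pullback_mem_closedForms hf

/-- The map `f^* : H^p(N) → H^p(M)`, `[α] ↦ [f^*α]`. -/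
def cohomologyPullback (f : M → N) (hf : ContMDiff (𝓡 n) (𝓡 m) ∞ f) :
    Cohomology m p N →ₗ[ℝ] Cohomology n p M :=
  Submodule.mapQ _ _ (closedPullback f hf) fun _ => pullback_mem_exactForms hf

end Forms

section Wedge

/-- The tensor product of two alternating forms:
`(v₁, …, v_r) ↦ a (v₁, …, v_p) * b (v_{p+1}, …, v_{p+q})`, where `r = p + q`;
see `tensorAlt_apply`. -/
def tensorAlt {V : Type*} [AddCommGroup V] [Module ℝ V] [TopologicalSpace V] {p q r : ℕ}
    (h : p + q = r) (a : V [⋀^Fin p]→L[ℝ] ℝ) (b : V [⋀^Fin q]→L[ℝ] ℝ) :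
    ContinuousMultilinearMap ℝ (fun _ : Fin r => V) ℝ where
  toMultilinearMap := ((LinearMap.mul' ℝ ℝ).compMultilinearMap
    (MultilinearMap.domCoprod a.toMultilinearMap b.toMultilinearMap)).domDomCongr
      (finSumFinEquiv.trans (finCongr h))
  cont := by
    change Continuous fun v : Fin r → V => a (fun i => v (Fin.cast h (Fin.castAdd q i))) *
      b (fun j => v (Fin.cast h (Fin.natAdd p j)))
    have ha := a.cont
    have hb := b.cont
    exact (ha.comp (continuous_pi fun i => continuous_apply _)).mul
      (hb.comp (continuous_pi fun i => continuous_apply _))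

theorem tensorAlt_apply {V : Type*} [AddCommGroup V] [Module ℝ V] [TopologicalSpace V] {p q r : ℕ}
    (h : p + q = r) (a : V [⋀^Fin p]→L[ℝ] ℝ) (b : V [⋀^Fin q]→L[ℝ] ℝ) (v : Fin r → V) :
    tensorAlt h a b v = a (fun i => v (Fin.cast h (Fin.castAdd q i))) *
      b (fun j => v (Fin.cast h (Fin.natAdd p j))) := rfl

/-- The wedge product `a ∧ b = 1 / (p! q!) ∑_σ sign(σ) (a ⊗ b) ∘ σ` of alternating forms. -/
def wedgeAlt {V : Type*} [AddCommGroup V] [Module ℝ V] [TopologicalSpace V] {p q r : ℕ}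
    (h : p + q = r) (a : V [⋀^Fin p]→L[ℝ] ℝ) (b : V [⋀^Fin q]→L[ℝ] ℝ) : V [⋀^Fin r]→L[ℝ] ℝ :=
  ((p.factorial : ℝ) * (q.factorial : ℝ))⁻¹ •
    ContinuousMultilinearMap.alternatization (tensorAlt h a b)

theorem wedgeAlt_apply {V : Type*} [AddCommGroup V] [Module ℝ V] [TopologicalSpace V] {p q r : ℕ}
    (h : p + q = r) (a : V [⋀^Fin p]→L[ℝ] ℝ) (b : V [⋀^Fin q]→L[ℝ] ℝ) (v : Fin r → V) :
    wedgeAlt h a b v = ((p.factorial : ℝ) * (q.factorial : ℝ))⁻¹ *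
      ∑ σ : Equiv.Perm (Fin r), ((Equiv.Perm.sign σ : ℤ) : ℝ) *
        (a (fun i => v (σ (Fin.cast h (Fin.castAdd q i)))) *
          b (fun j => v (σ (Fin.cast h (Fin.natAdd p j))))) := by
  simp only [wedgeAlt, ContinuousAlternatingMap.smul_apply, smul_eq_mul,
    ContinuousMultilinearMap.alternatization_apply_apply, tensorAlt_apply, Function.comp_apply,
    Units.smul_def, zsmul_eq_mul]

variable {n p q r : ℕ} {M : Type*} [TopologicalSpace M]
  [ChartedSpace (EuclideanSpace ℝ (Fin n)) M]

/-- The wedge product of differential forms. -/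
def wedge (h : p + q = r) (α : Form n p M) (β : Form n q M) : Form n r M :=
  ⟨fun x => wedgeAlt h (α.1 x) (β.1 x), by
    intro c
    rw [contDiffOn_alternating_iff]
    intro v
    have hα := contDiffOn_alternating_iff.1 (α.smooth c)
    have hβ := contDiffOn_alternating_iff.1 (β.smooth c)
    refine ContDiffOn.congr (f := fun y => wedgeAlt h (localRep α.1 c y) (localRep β.1 c y) v) ?_
      fun y _ => ?_
    · simp only [wedgeAlt_apply]
      exact contDiffOn_const.mul (ContDiffOn.sum fun σ _ =>
        contDiffOn_const.mul ((hα _).mul (hβ _)))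
    · rw [wedgeAlt_apply]
      exact wedgeAlt_apply h _ _ _⟩

end Wedge

section Integral

/-- `v` is positively oriented for `o`. Mathlib's `Orientation` is a ray of nonzero top-degree
alternating forms; `v` is positive if the forms on this ray are positive on `v`. In dimension `0`
the empty frame is positive for exactly one of the two orientations. -/
def IsPositiveFrame {n : ℕ} {V : Type*} [AddCommGroup V] [Module ℝ V]
    (o : Orientation ℝ V (Fin n)) (v : Fin n → V) : Prop :=
  ∃ (a : V [⋀^Fin n]→ₗ[ℝ] ℝ) (ha : a ≠ 0), o = rayOfNeZero ℝ a ha ∧ 0 < a v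

variable (n : ℕ) {M : Type*} [TopologicalSpace M] [ChartedSpace (EuclideanSpace ℝ (Fin n)) M]

/-- The coordinate frame `∂₁, …, ∂ₙ` of the chart around `c`, at the point with coordinates `y`. -/
def coordFrame (c : M) (y : EuclideanSpace ℝ (Fin n)) :
    Fin n → TangentSpace (𝓡 n) ((extChartAt (𝓡 n) c).symm y) :=
  fun i => mfderiv 𝓘(ℝ, EuclideanSpace ℝ (Fin n)) (𝓡 n) (extChartAt (𝓡 n) c).symm y
    (EuclideanSpace.single i (1 : ℝ))

variable (M) in
/-- An orientation of `M`: a continuous choice of an orientation of each tangent space. Continuity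
means that in every chart the sign of the coordinate frame is locally constant. -/
structure ManifoldOrientation where
  orientationAt : ∀ x : M, Orientation ℝ (TangentSpace (𝓡 n) x) (Fin n)
  locally_constant : ∀ (c : M), ∀ y₀ ∈ (extChartAt (𝓡 n) c).target, ∀ᶠ y in 𝓝 y₀,
    (IsPositiveFrame (orientationAt ((extChartAt (𝓡 n) c).symm y)) (coordFrame n c y) ↔
      IsPositiveFrame (orientationAt ((extChartAt (𝓡 n) c).symm y₀)) (coordFrame n c y₀))

variable {n}

open Classical in
/-- `1` if the coordinate frame of the chart around `c` is positive at the point with coordinates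
`y`, and `-1` otherwise. -/
def ManifoldOrientation.chartSign (o : ManifoldOrientation n M) (c : M)
    (y : EuclideanSpace ℝ (Fin n)) : ℝ :=
  if IsPositiveFrame (o.orientationAt ((extChartAt (𝓡 n) c).symm y)) (coordFrame n c y)
    then 1 else -1

variable [IsManifold (𝓡 n) ∞ M] [T2Space M] [CompactSpace M]

variable (n M) in
/-- A smooth partition of unity subordinate to the cover by chart domains. -/
def chartPartition : SmoothPartitionOfUnity M (𝓡 n) M Set.univ :=
  (SmoothPartitionOfUnity.exists_isSubordinate_chartAt_source (𝓡 n) M).choose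

/-- The integral `∫_M α` of an `n`-form over the compact oriented `n`-manifold `M`: the sum over the
partition of unity of the integrals of `± ρ_c α(∂₁, …, ∂ₙ) dy` in the charts, where the sign is `+`
where the chart is positively oriented and `-` where it is negatively oriented. Only finitely many
of the functions `ρ_c` are nonzero. -/
def integral (o : ManifoldOrientation n M) (α : Form n n M) : ℝ :=
  ∑ᶠ c : M, ∫ y in (extChartAt (𝓡 n) c).target,
    chartPartition n M c ((extChartAt (𝓡 n) c).symm y) *
      (o.chartSign c y * localRep α.1 c y (fun i => EuclideanSpace.single i (1 : ℝ)))

/-- `φ` preserves orientation: a frame at `x` is positive if and only if its image under `dφ_x` is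
positive. -/
def OrientationPreserving {N : Type*} [TopologicalSpace N]
    [ChartedSpace (EuclideanSpace ℝ (Fin n)) N] (oM : ManifoldOrientation n M)
    (oN : ManifoldOrientation n N) (φ : M → N) : Prop :=
  ∀ (x : M) (v : Fin n → TangentSpace (𝓡 n) x),
    IsPositiveFrame (oM.orientationAt x) v ↔
      IsPositiveFrame (oN.orientationAt (φ x)) (fun i => mfderiv (𝓡 n) (𝓡 n) φ x (v i))

end Integral

section Signature

variable {k : ℕ} {M : Type*} [TopologicalSpace M] [T2Space M] [CompactSpace M]
  [ChartedSpace (EuclideanSpace ℝ (Fin (4 * k))) M] [IsManifold (𝓡 (4 * k)) ∞ M]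

theorem two_mul_add_two_mul (k : ℕ) : 2 * k + 2 * k = 4 * k := by omega

/-- The signature form `Q([α], [β]) = ∫_M α ∧ β` on `H^{2k}(M)`, `dim M = 4k`. It is evaluated on a
choice of closed representatives of the two classes. -/
def signatureForm (o : ManifoldOrientation (4 * k) M) (a b : Cohomology (4 * k) (2 * k) M) : ℝ :=
  integral o (wedge (two_mul_add_two_mul k) a.out.1 b.out.1)

/-- The matrix of the signature form in a basis of `H^{2k}(M)`. -/
def signatureFormMatrix (o : ManifoldOrientation (4 * k) M) {s : ℕ}
    (b : Module.Basis (Fin s) ℝ (Cohomology (4 * k) (2 * k) M)) : Matrix (Fin s) (Fin s) ℝ :=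
  Matrix.of fun i j => signatureForm o (b i) (b j)

/-- The number of positive eigenvalues minus the number of negative eigenvalues, counted with
multiplicity. -/
def matrixSignature {s : ℕ} (A : Matrix (Fin s) (Fin s) ℝ) : ℤ :=
  (A.charpoly.roots.countP (fun t => 0 < t) : ℤ) - (A.charpoly.roots.countP (fun t => t < 0) : ℤ)

open Classical in
/-- The signature `σ(M)` of a compact oriented `4k`-manifold: the signature of the matrix of the
signature form in a basis of `H^{2k}(M)`. The de Rham cohomology of a compact manifold is
finite-dimensional, so the second branch never occurs. -/
def signature (o : ManifoldOrientation (4 * k) M) : ℤ :=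
  if _ : Module.Finite ℝ (Cohomology (4 * k) (2 * k) M) then
    matrixSignature (signatureFormMatrix o (Module.finBasis ℝ (Cohomology (4 * k) (2 * k) M)))
  else 0

end Signature
end DeRham

end

open DeRham

/-!
The proof rests on two properties of the integral over a compact oriented manifold: it is invariant
under orientation-preserving diffeomorphisms (`DeRham.integral_pullback`), and it vanishes on exact
forms (`DeRham.integral_extD_eq_zero`, Stokes' theorem).

Invariance is proved by refining by two partitions of unity. For indices `c` on `M` and `d` on `N`,
the form `(ρ_c ∘ φ⁻¹) ρ_d β` can be integrated in the chart around `d`, or pulled back and integrated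
in the chart around `c`; the two results agree by the change of variables formula, since the
Jacobian determinant of `φ` read in the charts has the sign by which the orientations of the two
coordinate frames differ (`DeRham.chartSign_mul_det`). Summing over `c` or over `d` gives the two
integrals. Applied to the identity map, the same formula shows that a form supported in the domain
of one chart may be integrated in this chart, which reduces Stokes' theorem to compactly supported
forms on Euclidean space.

If `β` is closed then `d(τ ∧ β) = dτ ∧ β` (`DeRham.extD_wedge_of_closed`), so by Stokes' theorem
`∫ α ∧ β` does not change if an exact form is added to `α`; forms of even degree commute, so the
same holds for `β`. Hence the signature form is well defined, bilinear and symmetric, and invariance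
of the integral together with `φ^*α ∧ φ^*β = φ^*(α ∧ β)` gives its invariance. The Leibniz rule is
proved at the level of alternating forms: `d` alternates the derivative of a form over its
arguments, and both sides are multiples of the same signed sum over all permutations.

The signature of the matrix of a symmetric bilinear form is the difference of the indices of
inertia of the associated quadratic form (`DeRham.matrixSignature_eq_sigPos_sub_sigNeg`), which does
not depend on the basis. A diffeomorphism carries a basis of `H^{2k}(N)` to one of `H^{2k}(M)` with
the same matrix.
The two cohomology spaces are isomorphic, so they are finite-dimensional simultaneously, which
settles the case distinction in the definition of the signature.
-/

noncomputable section

namespace DeRham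

/-! ### Signed sums over permutations -/

section AlternatingSum

variable {V : Type*} {r : ℕ}

/-- The signed sum `∑_σ sign(σ) f (v ∘ σ)` of a function `f` of `r` vectors. -/
def altSum (f : (Fin r → V) → ℝ) (v : Fin r → V) : ℝ :=
  ∑ σ : Equiv.Perm (Fin r), ((Equiv.Perm.sign σ : ℤ) : ℝ) * f (v ∘ σ)

theorem sign_mul_self_cast (c : Equiv.Perm (Fin r)) :
    ((Equiv.Perm.sign c : ℤ) : ℝ) * ((Equiv.Perm.sign c : ℤ) : ℝ) = 1 := by
  rw [← Int.cast_mul, ← Units.val_mul, Int.units_mul_self]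
  simp

/-- Reordering the arguments of `f` multiplies its signed sum by the sign of the reordering. -/
theorem altSum_comp_perm (f : (Fin r → V) → ℝ) (c : Equiv.Perm (Fin r)) (v : Fin r → V) :
    altSum (fun w => f (w ∘ c)) v = ((Equiv.Perm.sign c : ℤ) : ℝ) * altSum f v := by
  rw [altSum, altSum, Finset.mul_sum, ← Equiv.sum_comp (Equiv.mulRight c)
    (fun σ => ((Equiv.Perm.sign c : ℤ) : ℝ) * (((Equiv.Perm.sign σ : ℤ) : ℝ) * f (v ∘ σ)))]
  refine Finset.sum_congr rfl fun σ _ => ?_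
  simp only [Equiv.coe_mulRight, Equiv.Perm.sign_mul, Units.val_mul, Int.cast_mul]
  have h := sign_mul_self_cast c
  have e : v ∘ ⇑(σ * c) = (v ∘ σ) ∘ c := rfl
  rw [e]
  linear_combination (-((Equiv.Perm.sign σ : ℤ) : ℝ) * f ((v ∘ σ) ∘ c)) * h

theorem altSum_const_mul (k : ℝ) (f : (Fin r → V) → ℝ) (v : Fin r → V) :
    altSum (fun w => k * f w) v = k * altSum f v := by
  simp only [altSum, Finset.mul_sum]
  exact Finset.sum_congr rfl fun _ _ => by ring

theorem altSum_sum {ι : Type*} (s : Finset ι) (f : ι → (Fin r → V) → ℝ) (v : Fin r → V) :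
    altSum (fun w => ∑ i ∈ s, f i w) v = ∑ i ∈ s, altSum (f i) v := by
  simp only [altSum, Finset.mul_sum]
  exact Finset.sum_comm

theorem altSum_alternating [AddCommGroup V] [Module ℝ V] [TopologicalSpace V]
    (a : V [⋀^Fin r]→L[ℝ] ℝ) (v : Fin r → V) :
    altSum a v = (r.factorial : ℝ) * a v := by
  have h : ∀ σ : Equiv.Perm (Fin r),
      ((Equiv.Perm.sign σ : ℤ) : ℝ) * a (v ∘ σ) = a v := fun σ => by
    have := a.toAlternatingMap.map_perm v σ
    have h2 : a (v ∘ σ) = ((Equiv.Perm.sign σ : ℤ) : ℝ) * a v := by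
      simpa [Units.smul_def] using this
    rw [h2, ← mul_assoc, sign_mul_self_cast, one_mul]
  simp [altSum, h, Fintype.card_perm]

/-- Moving the `i`-th argument to the front is the inverse of the cycle `(0 1 … i)`. -/
theorem comp_cycleRange_symm (v : Fin (r + 1) → V) (i : Fin (r + 1)) :
    v ∘ i.cycleRange.symm = Fin.cons (v i) (i.removeNth v) := by
  funext j
  refine Fin.cases ?_ (fun j => ?_) j
  · simp
  · simp [Fin.removeNth]

theorem sign_cycleRange_symm_cast (i : Fin (r + 1)) :
    ((Equiv.Perm.sign i.cycleRange.symm : ℤ) : ℝ) = (-1) ^ (i : ℕ) := by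
  rw [Equiv.Perm.sign_symm, Fin.sign_cycleRange]
  simp

/-- All terms contribute equally, as the sign `(-1)^i` cancels the sign of the permutation `c i`. -/
theorem altSum_sum_perm {m : ℕ} (c : Fin m → Equiv.Perm (Fin r))
    (hc : ∀ i, ((Equiv.Perm.sign (c i) : ℤ) : ℝ) = (-1) ^ (i : ℕ)) (f : (Fin r → V) → ℝ)
    (v : Fin r → V) :
    altSum (fun w => ∑ i : Fin m, (-1) ^ (i : ℕ) * f (w ∘ c i)) v = (m : ℝ) * altSum f v := by
  have h : ∀ i : Fin m,
      altSum (fun w => (-1) ^ (i : ℕ) * f (w ∘ c i)) v = altSum f v := fun i => by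
    rw [altSum_const_mul, altSum_comp_perm, ← hc, ← mul_assoc, sign_mul_self_cast, one_mul]
  rw [altSum_sum]
  simp [h]

/-- Antisymmetrizing twice: the signed sum of `w ↦ f w_0 (w_1, …)`, already antisymmetrized in the
last `r` arguments, is `r!` times the full signed sum. -/
theorem altSum_altSum_tail (f : (Fin (r + 1) → V) → ℝ) (v : Fin (r + 1) → V) :
    altSum (fun w => altSum (fun u => f (Fin.cons (w 0) u)) (Fin.tail w)) v =
      (r.factorial : ℝ) * altSum f v := by
  have h1 : ∀ w : Fin (r + 1) → V, altSum (fun u => f (Fin.cons (w 0) u)) (Fin.tail w) =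
      ∑ ρ : Equiv.Perm (Fin r), ((Equiv.Perm.sign ρ : ℤ) : ℝ) *
        f (w ∘ Equiv.Perm.decomposeFin.symm (0, ρ)) := fun w => by
    refine Finset.sum_congr rfl fun ρ _ => ?_
    refine congrArg (fun u => ((Equiv.Perm.sign ρ : ℤ) : ℝ) * f u) ?_
    funext j
    refine Fin.cases ?_ (fun j => ?_) j
    · simp
    · simp [Fin.tail]
  simp only [h1]
  rw [altSum_sum]
  have h2 : ∀ ρ : Equiv.Perm (Fin r), altSum (fun w => ((Equiv.Perm.sign ρ : ℤ) : ℝ) *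
        f (w ∘ Equiv.Perm.decomposeFin.symm (0, ρ))) v = altSum f v := fun ρ => by
    rw [altSum_const_mul, altSum_comp_perm, Equiv.Perm.decomposeFin.symm_sign, if_pos rfl, one_mul,
      ← mul_assoc, sign_mul_self_cast, one_mul]
  simp [h2, Fintype.card_perm]

end AlternatingSum

/-! ### Algebra of the wedge product -/

section WedgeAlgebra

variable {V : Type*} [AddCommGroup V] [Module ℝ V] [TopologicalSpace V] {p q r : ℕ}

theorem wedgeAlt_eq_altSum (h : p + q = r) (a : V [⋀^Fin p]→L[ℝ] ℝ) (b : V [⋀^Fin q]→L[ℝ] ℝ)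
    (v : Fin r → V) :
    wedgeAlt h a b v = ((p.factorial : ℝ) * (q.factorial : ℝ))⁻¹ *
      altSum (fun w => a (fun i => w (Fin.cast h (Fin.castAdd q i))) *
          b (fun j => w (Fin.cast h (Fin.natAdd p j)))) v :=
  wedgeAlt_apply h a b v

theorem wedgeAlt_compContinuousLinearMap {W : Type*} [AddCommGroup W] [Module ℝ W]
    [TopologicalSpace W] (h : p + q = r) (a : V [⋀^Fin p]→L[ℝ] ℝ) (b : V [⋀^Fin q]→L[ℝ] ℝ)
    (L : W →L[ℝ] V) :
    wedgeAlt h (a.compContinuousLinearMap L) (b.compContinuousLinearMap L) =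
      (wedgeAlt h a b).compContinuousLinearMap L := by
  ext v
  rw [ContinuousAlternatingMap.compContinuousLinearMap_apply, wedgeAlt_apply, wedgeAlt_apply]
  rfl

theorem wedgeAlt_add_left (h : p + q = r) (a a' : V [⋀^Fin p]→L[ℝ] ℝ)
    (b : V [⋀^Fin q]→L[ℝ] ℝ) : wedgeAlt h (a + a') b = wedgeAlt h a b + wedgeAlt h a' b := by
  ext v
  rw [ContinuousAlternatingMap.add_apply, wedgeAlt_apply, wedgeAlt_apply, wedgeAlt_apply, ← mul_add,
    ← Finset.sum_add_distrib]
  simp only [ContinuousAlternatingMap.add_apply, add_mul, mul_add]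

theorem wedgeAlt_smul_left (h : p + q = r) (t : ℝ) (a : V [⋀^Fin p]→L[ℝ] ℝ)
    (b : V [⋀^Fin q]→L[ℝ] ℝ) : wedgeAlt h (t • a) b = t • wedgeAlt h a b := by
  ext v
  rw [ContinuousAlternatingMap.smul_apply, wedgeAlt_eq_altSum, wedgeAlt_eq_altSum, smul_eq_mul,
    mul_left_comm]
  simp only [ContinuousAlternatingMap.smul_apply, smul_eq_mul, mul_assoc, altSum_const_mul]

/-- The permutation of `Fin r` exchanging the first `p` with the last `q` indices. -/
def blockSwap (h : p + q = r) (h' : q + p = r) : Equiv.Perm (Fin r) :=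
  ((finSumFinEquiv.trans (finCongr h')).symm.trans (Equiv.sumComm _ _)).trans
    (finSumFinEquiv.trans (finCongr h))

theorem wedgeAlt_comm (h : p + q = r) (h' : q + p = r) (a : V [⋀^Fin p]→L[ℝ] ℝ)
    (b : V [⋀^Fin q]→L[ℝ] ℝ) :
    wedgeAlt h a b = ((Equiv.Perm.sign (blockSwap h h') : ℤ) : ℝ) • wedgeAlt h' b a := by
  ext v
  rw [ContinuousAlternatingMap.smul_apply, wedgeAlt_eq_altSum, wedgeAlt_eq_altSum, smul_eq_mul,
    mul_left_comm, mul_comm (q.factorial : ℝ), ← mul_assoc, mul_assoc, ← mul_assoc _ _ (altSum _ _),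
    mul_assoc]
  congr 1
  have e := altSum_comp_perm (fun w : Fin r → V => b (fun i => w (Fin.cast h' (Fin.castAdd p i))) *
          a (fun j => w (Fin.cast h' (Fin.natAdd q j)))) (blockSwap h h') v
  rw [← e]
  congr 1
  funext w
  rw [mul_comm]
  congr 2
  · funext i
    simp [blockSwap]
  · funext i
    simp [blockSwap]

/-- Exchanging two blocks of the same size `p` is a product of `p` disjoint transpositions. -/
theorem sign_blockSwap_self {p r : ℕ} (hp : Even p) (h : p + p = r) :
    Equiv.Perm.sign (blockSwap h h) = 1 := by
  have h1 : Equiv.Perm.sign (blockSwap h h) =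
      Equiv.Perm.sign (Equiv.prodCongrRight (fun _ : Fin p => Equiv.boolNot)) := by
    refine Equiv.Perm.sign_eq_sign_of_equiv _ _ ((((Equiv.prodComm _ _).trans
      (Equiv.boolProdEquivSum (Fin p))).trans finSumFinEquiv).trans (finCongr h)).symm ?_
    intro i
    let e := finSumFinEquiv.trans (finCongr h)
    let g := (Equiv.prodComm (Fin p) Bool).trans (Equiv.boolProdEquivSum (Fin p))
    obtain ⟨x, rfl⟩ := e.surjective i
    change g.symm (e.symm (e (Sum.swap (e.symm (e x))))) =
      Equiv.prodCongrRight (fun _ : Fin p => Equiv.boolNot) (g.symm (e.symm (e x)))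
    rw [Equiv.symm_apply_apply, Equiv.symm_apply_apply]
    cases x <;> rfl
  have h2 : Equiv.Perm.sign Equiv.boolNot = -1 := by decide
  rw [h1, Equiv.Perm.sign_prodCongrRight]
  simp [h2, hp.neg_one_pow]

/-- The permutation of `Fin (r + 1)` moving the `i`-th of the first `p + 1` indices to the front
and fixing the last `q`. -/
def frontCycle (h : p + 1 + q = r + 1) (i : Fin (p + 1)) : Equiv.Perm (Fin (r + 1)) :=
  (finSumFinEquiv.trans (finCongr h)).permCongr (Equiv.Perm.sumCongr i.cycleRange.symm 1)

theorem sign_frontCycle_cast (h : p + 1 + q = r + 1) (i : Fin (p + 1)) :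
    ((Equiv.Perm.sign (frontCycle h i) : ℤ) : ℝ) = (-1) ^ (i : ℕ) := by
  rw [frontCycle, Equiv.Perm.sign_permCongr, Equiv.Perm.sign_sumCongr, Equiv.Perm.sign_one, mul_one,
    sign_cycleRange_symm_cast]

end WedgeAlgebra

/-! ### The algebraic Leibniz rule -/

section Leibniz

variable {V : Type*} [NormedAddCommGroup V] [NormedSpace ℝ V] {p q r : ℕ}

/-- The algebraic Leibniz rule. Both sides are `1 / (p! q!)` times the signed sum of
`A v_0 (v_1, …, v_p) b (v_{p+1}, …)` over all permutations of the arguments. -/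
theorem alternatizeUncurryFin_wedgeAlt (h : p + q = r) (h' : p + 1 + q = r + 1)
    (A : V →L[ℝ] V [⋀^Fin p]→L[ℝ] ℝ) (b : V [⋀^Fin q]→L[ℝ] ℝ)
    (W : V →L[ℝ] V [⋀^Fin r]→L[ℝ] ℝ) (hW : ∀ u, W u = wedgeAlt h (A u) b) :
    ContinuousAlternatingMap.alternatizeUncurryFin W =
      wedgeAlt h' (ContinuousAlternatingMap.alternatizeUncurryFin A) b := by
  ext v
  let T : (Fin (r + 1) → V) → ℝ := fun w =>
    A (w 0) (fun i => w (Fin.cast h (Fin.castAdd q i)).succ) *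
      b (fun j => w (Fin.cast h (Fin.natAdd p j)).succ)
  let K : ℝ := ((p.factorial : ℝ) * (q.factorial : ℝ))⁻¹
  have hW' : ∀ (u : V) (w : Fin r → V), W u w = K * altSum (fun w => T (Fin.cons u w)) w := by
    intro u w
    rw [hW, wedgeAlt_eq_altSum]
    simp only [T, Fin.cons_zero, Fin.cons_succ, K]
  have hr : ((r + 1).factorial : ℝ) ≠ 0 := by positivity
  -- The left-hand side `U` is alternating, so its signed sum is `(r + 1)! U`. On the other hand, its
  -- `r + 1` terms contribute equally, each of them `K r!` times the signed sum of `T`.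
  have h1 : ContinuousAlternatingMap.alternatizeUncurryFin W v = K * altSum T v := by
    have e1 := altSum_alternating (ContinuousAlternatingMap.alternatizeUncurryFin W) v
    have e2 : (ContinuousAlternatingMap.alternatizeUncurryFin W : (Fin (r + 1) → V) → ℝ) =
        fun w => ∑ i : Fin (r + 1), (-1) ^ (i : ℕ) *
          (fun w => W (w 0) (Fin.tail w)) (w ∘ i.cycleRange.symm) := by
      funext w
      rw [ContinuousAlternatingMap.alternatizeUncurryFin_apply]
      refine Finset.sum_congr rfl fun i _ => ?_
      simp only [comp_cycleRange_symm, Fin.cons_zero, Fin.tail_cons]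
      simp
    have e3 : altSum (fun w => W (w 0) (Fin.tail w)) v = K * ((r.factorial : ℝ) * altSum T v) := by
      simp only [hW']
      rw [altSum_const_mul, altSum_altSum_tail]
    rw [e2, altSum_sum_perm _ sign_cycleRange_symm_cast (fun w => W (w 0) (Fin.tail w)), e3,
      ← e2] at e1
    refine mul_left_cancel₀ hr (e1.symm.trans ?_)
    rw [Nat.factorial_succ]
    push_cast
    ring
  -- On the right-hand side, the `p + 1` terms of `d A` are `T` after moving one argument to the front.
  have h2 : (fun w : Fin (r + 1) → V => ContinuousAlternatingMap.alternatizeUncurryFin A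
        (fun i => w (Fin.cast h' (Fin.castAdd q i))) * b (fun j => w (Fin.cast h' (Fin.natAdd _ j)))) =
      fun w => ∑ i : Fin (p + 1), (-1) ^ (i : ℕ) * T (w ∘ frontCycle h' i) := by
    funext w
    rw [ContinuousAlternatingMap.alternatizeUncurryFin_apply, Finset.sum_mul]
    refine Finset.sum_congr rfl fun i _ => ?_
    have c0 : frontCycle h' i 0 = Fin.cast h' (Fin.castAdd q i) := by
      have : (0 : Fin (r + 1)) = (finSumFinEquiv.trans (finCongr h')) (Sum.inl 0) := by
        ext; simp
      rw [this, frontCycle, Equiv.permCongr_apply, Equiv.symm_apply_apply]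
      simp
    have c1 : ∀ j : Fin p, frontCycle h' i (Fin.cast h (Fin.castAdd q j)).succ =
        Fin.cast h' (Fin.castAdd q (i.succAbove j)) := by
      intro j
      have : (Fin.cast h (Fin.castAdd q j)).succ =
          (finSumFinEquiv.trans (finCongr h')) (Sum.inl j.succ) := by
        ext; simp
      rw [this, frontCycle, Equiv.permCongr_apply, Equiv.symm_apply_apply]
      simp
    have c2 : ∀ j : Fin q, frontCycle h' i (Fin.cast h (Fin.natAdd p j)).succ =
        Fin.cast h' (Fin.natAdd (p + 1) j) := by
      intro j
      have : (Fin.cast h (Fin.natAdd p j)).succ =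
          (finSumFinEquiv.trans (finCongr h')) (Sum.inr j) := by
        ext; simp; omega
      rw [this, frontCycle, Equiv.permCongr_apply, Equiv.symm_apply_apply]
      simp
    simp only [T, Function.comp_apply, c0, c1, c2]
    rw [zsmul_eq_mul, mul_assoc]
    push_cast
    rfl
  rw [h1, wedgeAlt_eq_altSum, h2, altSum_sum_perm _ (sign_frontCycle_cast h'), Nat.factorial_succ]
  have : ((p.factorial : ℕ) : ℝ) ≠ 0 := by positivity
  have : ((q.factorial : ℕ) : ℝ) ≠ 0 := by positivity
  simp only [K]
  push_cast
  field_simp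

end Leibniz

/-! ### The Leibniz rule for forms on a vector space -/

section LeibnizForms

variable {V : Type*} [NormedAddCommGroup V] [NormedSpace ℝ V] {p q r : ℕ}

theorem fderiv_wedgeAlt_apply (h : p + q = r) {a : V → V [⋀^Fin p]→L[ℝ] ℝ}
    {b : V → V [⋀^Fin q]→L[ℝ] ℝ} {y : V} (ha : DifferentiableAt ℝ a y)
    (hb : DifferentiableAt ℝ b y)
    (hab : DifferentiableAt ℝ (fun z => wedgeAlt h (a z) (b z)) y) (u : V) (v : Fin r → V) :
    fderiv ℝ (fun z => wedgeAlt h (a z) (b z)) y u v =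
      wedgeAlt h (fderiv ℝ a y u) (b y) v + wedgeAlt h (a y) (fderiv ℝ b y u) v := by
  have h1 := (ContinuousAlternatingMap.apply ℝ V ℝ v).hasFDerivAt.comp y hab.hasFDerivAt
  have ha' : ∀ w, HasFDerivAt (fun z => a z w) _ y := fun w =>
    (ContinuousAlternatingMap.apply ℝ V ℝ w).hasFDerivAt.comp y ha.hasFDerivAt
  have hb' : ∀ w, HasFDerivAt (fun z => b z w) _ y := fun w =>
    (ContinuousAlternatingMap.apply ℝ V ℝ w).hasFDerivAt.comp y hb.hasFDerivAt
  have h2 := (HasFDerivAt.fun_sum (u := Finset.univ) fun (σ : Equiv.Perm (Fin r)) _ =>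
    ((ha' (fun i => v (σ (Fin.cast h (Fin.castAdd q i))))).mul
      (hb' (fun j => v (σ (Fin.cast h (Fin.natAdd p j)))))).const_mul
        ((Equiv.Perm.sign σ : ℤ) : ℝ)).const_mul (((p.factorial : ℝ) * (q.factorial : ℝ))⁻¹)
  have h3 : (ContinuousAlternatingMap.apply ℝ V ℝ v) ∘ (fun z => wedgeAlt h (a z) (b z)) = _ :=
    funext fun z => wedgeAlt_apply h (a z) (b z) v
  rw [h3] at h1
  have h4 := DFunLike.congr_fun (h1.unique h2) u
  refine Eq.trans h4 ?_
  rw [wedgeAlt_apply, wedgeAlt_apply, ← mul_add, ← Finset.sum_add_distrib]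
  simp only [_root_.smul_apply, _root_.sum_apply, smul_eq_mul]
  congr 1
  refine Finset.sum_congr rfl fun σ _ => ?_
  simp only [_root_.add_apply, _root_.smul_apply, smul_eq_mul,
    ContinuousLinearMap.comp_apply, ContinuousAlternatingMap.apply_apply]
  ring

variable [FiniteDimensional ℝ V]

/-- The linear map `u ↦ A u ∧ b`. -/
def wedgeLeftCLM (h : p + q = r) (A : V →L[ℝ] V [⋀^Fin p]→L[ℝ] ℝ) (b : V [⋀^Fin q]→L[ℝ] ℝ) :
    V →L[ℝ] V [⋀^Fin r]→L[ℝ] ℝ :=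
  LinearMap.toContinuousLinearMap
    { toFun := fun u => wedgeAlt h (A u) b
      map_add' := fun u u' => by rw [map_add, wedgeAlt_add_left]
      map_smul' := fun t u => by rw [map_smul, wedgeAlt_smul_left]; rfl }

/-- The Leibniz rule on a vector space. The factors of the second term are exchanged, so that both
terms are instances of `alternatizeUncurryFin_wedgeAlt`; the sign is that of the exchange. -/
theorem extDeriv_wedgeAlt (h : p + q = r) (h' : p + 1 + q = r + 1) (g : q + p = r)
    (g' : q + 1 + p = r + 1) {a : V → V [⋀^Fin p]→L[ℝ] ℝ}
    {b : V → V [⋀^Fin q]→L[ℝ] ℝ} {y : V} (ha : DifferentiableAt ℝ a y)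
    (hb : DifferentiableAt ℝ b y)
    (hab : DifferentiableAt ℝ (fun z => wedgeAlt h (a z) (b z)) y) :
    extDeriv (fun z => wedgeAlt h (a z) (b z)) y = wedgeAlt h' (extDeriv a y) (b y) +
      ((Equiv.Perm.sign (blockSwap h g) : ℤ) : ℝ) • wedgeAlt g' (extDeriv b y) (a y) := by
  have h1 : fderiv ℝ (fun z => wedgeAlt h (a z) (b z)) y = wedgeLeftCLM h (fderiv ℝ a y) (b y) +
      ((Equiv.Perm.sign (blockSwap h g) : ℤ) : ℝ) • wedgeLeftCLM g (fderiv ℝ b y) (a y) := by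
    ext u v
    rw [fderiv_wedgeAlt_apply h ha hb hab, wedgeAlt_comm h g (a y)]
    rfl
  rw [extDeriv, h1, ContinuousAlternatingMap.alternatizeUncurryFin_add,
    ContinuousAlternatingMap.alternatizeUncurryFin_smul,
    alternatizeUncurryFin_wedgeAlt h h' (fderiv ℝ a y) (b y) _ (fun _ => rfl),
    alternatizeUncurryFin_wedgeAlt g g' (fderiv ℝ b y) (a y) _ (fun _ => rfl)]
  rfl

end LeibnizForms

/-! ### The wedge product on manifolds -/

section WedgeForms

variable {n p q r : ℕ} {M : Type*} [TopologicalSpace M]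
  [ChartedSpace (EuclideanSpace ℝ (Fin n)) M]

theorem localRep_wedge (h : p + q = r) (α : Form n p M) (β : Form n q M) (c : M)
    (y : EuclideanSpace ℝ (Fin n)) :
    localRep (wedge h α β).1 c y = wedgeAlt h (localRep α.1 c y) (localRep β.1 c y) :=
  (wedgeAlt_compContinuousLinearMap h _ _ _).symm

theorem wedge_comm (h : p + q = r) (h' : q + p = r) (α : Form n p M) (β : Form n q M) :
    wedge h α β = ((Equiv.Perm.sign (blockSwap h h') : ℤ) : ℝ) • wedge h' β α :=
  Subtype.ext (funext fun x => wedgeAlt_comm h h' (α.1 x) (β.1 x))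

theorem wedge_comm_of_even (hp : Even p) (h : p + p = r) (α β : Form n p M) :
    wedge h α β = wedge h β α := by
  rw [wedge_comm h h, sign_blockSwap_self hp]
  simp

theorem wedge_add_left (h : p + q = r) (α α' : Form n p M) (β : Form n q M) :
    wedge h (α + α') β = wedge h α β + wedge h α' β :=
  Subtype.ext (funext fun x => wedgeAlt_add_left h (α.1 x) (α'.1 x) (β.1 x))

theorem wedge_smul_left (h : p + q = r) (t : ℝ) (α : Form n p M) (β : Form n q M) :
    wedge h (t • α) β = t • wedge h α β :=
  Subtype.ext (funext fun x => wedgeAlt_smul_left h t (α.1 x) (β.1 x))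

theorem wedge_zero_left (h : p + q = r) (β : Form n q M) : wedge h 0 β = 0 := by
  simpa using wedge_smul_left h 0 0 β

variable [IsManifold (𝓡 n) ∞ M]

theorem extDeriv_localRep_of_closed {β : Form n q M} (hβ : β ∈ closedForms n q M) (c : M)
    {y : EuclideanSpace ℝ (Fin n)} (hy : y ∈ (extChartAt (𝓡 n) c).target) :
    _root_.extDeriv (localRep β.1 c) y = 0 := by
  rw [← localRep_extDerivField β.smooth c hy]
  have h0 : extD β = 0 := hβ
  exact congrArg (fun γ : Form n (q + 1) M => localRep γ.1 c y) h0

/-- If `β` is closed, then `α ↦ α ∧ β` commutes with `d`. -/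
theorem extD_wedge_of_closed (h : p + q = r) (h' : p + 1 + q = r + 1) (α : Form n p M)
    {β : Form n q M} (hβ : β ∈ closedForms n q M) :
    extD (wedge h α β) = wedge h' (extD α) β := by
  refine Subtype.ext (eq_of_localRep_eq fun c y hy => ?_)
  have hn := (isOpen_extChartAt_target (I := 𝓡 n) c).mem_nhds hy
  have hw : localRep (wedge h α β).1 c =
      fun z => wedgeAlt h (localRep α.1 c z) (localRep β.1 c z) :=
    funext fun z => localRep_wedge h α β c z
  have hd := (((wedge h α β).smooth c).contDiffAt hn).differentiableAt (by simp)
  refine (localRep_extDerivField (wedge h α β).smooth c hy).trans ?_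
  rw [localRep_wedge]
  rw [hw] at hd ⊢
  rw [extDeriv_wedgeAlt h h' (by omega) (by omega)
    (((α.smooth c).contDiffAt hn).differentiableAt (by simp))
    (((β.smooth c).contDiffAt hn).differentiableAt (by simp)) hd,
    extDeriv_localRep_of_closed hβ c hy]
  have e : localRep (extD α).1 c y = _root_.extDeriv (localRep α.1 c) y :=
    localRep_extDerivField α.smooth c hy
  rw [e]
  have h0 : wedgeAlt (by omega : q + 1 + p = r + 1)
      (0 : EuclideanSpace ℝ (Fin n) [⋀^Fin (q + 1)]→L[ℝ] ℝ) (localRep α.1 c y) = 0 := by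
    simpa using wedgeAlt_smul_left (by omega : q + 1 + p = r + 1) 0
      (0 : EuclideanSpace ℝ (Fin n) [⋀^Fin (q + 1)]→L[ℝ] ℝ) (localRep α.1 c y)
  rw [h0, smul_zero, add_zero]

theorem wedge_pullback {m : ℕ} {N : Type*} [TopologicalSpace N]
    [ChartedSpace (EuclideanSpace ℝ (Fin m)) N] [IsManifold (𝓡 m) ∞ N] {f : M → N}
    (hf : ContMDiff (𝓡 n) (𝓡 m) ∞ f) (h : p + q = r) (α : Form m p N) (β : Form m q N) :
    wedge h (pullback f hf α) (pullback f hf β) = pullback f hf (wedge h α β) :=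
  Subtype.ext (funext fun x =>
    wedgeAlt_compContinuousLinearMap h (α.1 (f x)) (β.1 (f x)) (mfderiv (𝓡 n) (𝓡 m) f x))

end WedgeForms

/-! ### Determinants and orientations of frames -/

section Frames

variable {n : ℕ}

/-- A top-degree form scales by the determinant under a linear map. -/
theorem alternating_apply_comp_single (a : EuclideanSpace ℝ (Fin n) [⋀^Fin n]→ₗ[ℝ] ℝ)
    (L : EuclideanSpace ℝ (Fin n) →L[ℝ] EuclideanSpace ℝ (Fin n)) :
    a (fun i => L (EuclideanSpace.single i (1 : ℝ))) =
      L.det * a (fun i => EuclideanSpace.single i (1 : ℝ)) := by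
  let b := (EuclideanSpace.basisFun (Fin n) ℝ).toBasis
  have hb : (b : Fin n → EuclideanSpace ℝ (Fin n)) = fun i => EuclideanSpace.single i (1 : ℝ) := by
    funext i; simp [b]
  have h := a.eq_smul_basis_det b
  rw [hb] at h
  have h2 : b.det ((L : EuclideanSpace ℝ (Fin n) →ₗ[ℝ] EuclideanSpace ℝ (Fin n)) ∘ b) =
      L.det * b.det b := b.det_comp _ _
  rw [b.det_self, mul_one, hb] at h2
  conv_lhs => rw [h]
  rw [AlternatingMap.smul_apply, smul_eq_mul, mul_comm]
  congr 1

theorem alternating_apply_single_ne_zero {a : EuclideanSpace ℝ (Fin n) [⋀^Fin n]→ₗ[ℝ] ℝ}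
    (ha : a ≠ 0) : a (fun i => EuclideanSpace.single i (1 : ℝ)) ≠ 0 := by
  let b := (EuclideanSpace.basisFun (Fin n) ℝ).toBasis
  have hb : (b : Fin n → EuclideanSpace ℝ (Fin n)) = fun i => EuclideanSpace.single i (1 : ℝ) := by
    funext i; simp [b]
  intro h
  have h' := a.eq_smul_basis_det b
  rw [hb, h, zero_smul] at h'
  exact ha h'

/-- Whether a frame is positive may be tested on any form representing the orientation. -/
theorem isPositiveFrame_rayOfNeZero_iff {V : Type*} [AddCommGroup V] [Module ℝ V]
    {a : V [⋀^Fin n]→ₗ[ℝ] ℝ} (ha : a ≠ 0) (v : Fin n → V) :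
    IsPositiveFrame (rayOfNeZero ℝ a ha) v ↔ 0 < a v := by
  constructor
  · rintro ⟨a', ha', h, hv⟩
    obtain ⟨s, t, hs, ht, hst⟩ := ((ray_eq_iff ha ha').1 h).exists_pos ha ha'
    have h2 : s * a v = t * a' v := by
      simpa using DFunLike.congr_fun hst v
    have h3 : 0 < s * a v := h2 ▸ mul_pos ht hv
    exact pos_of_mul_pos_right h3 hs.le
  · exact fun h => ⟨a, ha, rfl, h⟩

open Classical in
/-- `1` if the frame `v` is positive for `o`, and `-1` otherwise. -/
def frameSign {V : Type*} [AddCommGroup V] [Module ℝ V] (o : Orientation ℝ V (Fin n))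
    (v : Fin n → V) : ℝ :=
  if IsPositiveFrame o v then 1 else -1

theorem frameSign_congr {V W : Type*} [AddCommGroup V] [Module ℝ V] [AddCommGroup W] [Module ℝ W]
    {o : Orientation ℝ V (Fin n)} {o' : Orientation ℝ W (Fin n)} {v : Fin n → V} {w : Fin n → W}
    (h : IsPositiveFrame o v ↔ IsPositiveFrame o' w) : frameSign o v = frameSign o' w := by
  by_cases h' : IsPositiveFrame o v
  · rw [frameSign, frameSign, if_pos h', if_pos (h.1 h')]
  · rw [frameSign, frameSign, if_neg h', if_neg fun h'' => h' (h.2 h'')]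

/-- Applying `L` to a frame flips its sign when `L.det < 0`; multiplying by `L.det` covers also the
degenerate case `L.det = 0`, where the image is not a frame. -/
theorem frameSign_mul_det (o : Orientation ℝ (EuclideanSpace ℝ (Fin n)) (Fin n))
    {B : EuclideanSpace ℝ (Fin n) →L[ℝ] EuclideanSpace ℝ (Fin n)} (hB : B.det ≠ 0)
    (L : EuclideanSpace ℝ (Fin n) →L[ℝ] EuclideanSpace ℝ (Fin n)) :
    frameSign o (fun i => B (L (EuclideanSpace.single i (1 : ℝ)))) * L.det =
      |L.det| * frameSign o (fun i => B (EuclideanSpace.single i (1 : ℝ))) := by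
  induction o using Module.Ray.ind with
  | h a ha =>
    have h1 := alternating_apply_comp_single a B
    have h2 := alternating_apply_comp_single a (B.comp L)
    have h3 : (B.comp L).det = B.det * L.det := by
      simp [ContinuousLinearMap.det, LinearMap.det_comp]
    rw [h3, mul_right_comm, ← h1] at h2
    have h0 : a (fun i => B (EuclideanSpace.single i (1 : ℝ))) ≠ 0 := by
      rw [h1]; exact mul_ne_zero hB (alternating_apply_single_ne_zero ha)
    have h2' : a (fun i => B (L (EuclideanSpace.single i (1 : ℝ)))) =
      a (fun i => B (EuclideanSpace.single i (1 : ℝ))) * L.det := h2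
    simp only [frameSign, isPositiveFrame_rayOfNeZero_iff, h2']
    rcases lt_trichotomy L.det 0 with hL | hL | hL
    · rw [abs_of_neg hL]
      rcases lt_or_gt_of_ne h0 with hb | hb
      · rw [if_pos (mul_pos_of_neg_of_neg hb hL), if_neg hb.le.not_gt]; ring
      · rw [if_neg (mul_neg_of_pos_of_neg hb hL).le.not_gt, if_pos hb]; ring
    · simp [hL]
    · rw [abs_of_pos hL]
      rcases lt_or_gt_of_ne h0 with hb | hb
      · rw [if_neg (mul_neg_of_neg_of_pos hb hL).le.not_gt, if_neg hb.le.not_gt]; ring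
      · rw [if_pos (mul_pos hb hL), if_pos hb]; ring

end Frames

/-! ### Orientation signs of charts -/

section ChartSign

variable {n : ℕ} {M : Type*} [TopologicalSpace M] [ChartedSpace (EuclideanSpace ℝ (Fin n)) M]
  {N : Type*} [TopologicalSpace N] [ChartedSpace (EuclideanSpace ℝ (Fin n)) N]

theorem chartSign_eventuallyEq (o : ManifoldOrientation n M) (c : M)
    {y₀ : EuclideanSpace ℝ (Fin n)} (hy : y₀ ∈ (extChartAt (𝓡 n) c).target) :
    ∀ᶠ y in 𝓝 y₀, o.chartSign c y = o.chartSign c y₀ := by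
  filter_upwards [o.locally_constant c y₀ hy] with y h
  exact frameSign_congr h

theorem localRep_eq_zero {p : ℕ} {α : FormField n p M} {c : M} {y : EuclideanSpace ℝ (Fin n)}
    (h : α ((extChartAt (𝓡 n) c).symm y) = 0) : localRep α c y = 0 := by
  rw [localRep, h]
  rfl

variable [IsManifold (𝓡 n) ∞ M] [IsManifold (𝓡 n) ∞ N]

theorem det_mfderiv_extChartAt_symm_ne_zero (c : M) {y : EuclideanSpace ℝ (Fin n)}
    (hy : y ∈ (extChartAt (𝓡 n) c).target) :
    ContinuousLinearMap.det (show EuclideanSpace ℝ (Fin n) →L[ℝ] EuclideanSpace ℝ (Fin n) from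
      mfderiv 𝓘(ℝ, EuclideanSpace ℝ (Fin n)) (𝓡 n) (extChartAt (𝓡 n) c).symm y) ≠ 0 := by
  have : IsManifold (𝓡 n) 1 M := IsManifold.of_le (n := ∞) (by simp)
  have h := mfderiv_extChartAt_comp_mfderivWithin_extChartAt_symm (I := 𝓡 n) hy
  rw [ModelWithCorners.range_eq_univ, mfderivWithin_univ] at h
  let A : EuclideanSpace ℝ (Fin n) →L[ℝ] EuclideanSpace ℝ (Fin n) :=
    mfderiv (𝓡 n) 𝓘(ℝ, EuclideanSpace ℝ (Fin n)) (extChartAt (𝓡 n) c)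
      ((extChartAt (𝓡 n) c).symm y)
  let B : EuclideanSpace ℝ (Fin n) →L[ℝ] EuclideanSpace ℝ (Fin n) :=
    mfderiv 𝓘(ℝ, EuclideanSpace ℝ (Fin n)) (𝓡 n) (extChartAt (𝓡 n) c).symm y
  have hAB : A.comp B = ContinuousLinearMap.id ℝ _ := h
  have hdet : A.det * B.det = 1 := by
    have := congrArg ContinuousLinearMap.det hAB
    simpa [ContinuousLinearMap.det, LinearMap.det_comp] using this
  exact right_ne_zero_of_mul_eq_one hdet

/-- The chain rule for `f` read in charts. -/
theorem mfderiv_symm_fderiv_coordMap {f : M → N} (hf : ContMDiff (𝓡 n) (𝓡 n) ∞ f) (c : M) (c' : N)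
    {y : EuclideanSpace ℝ (Fin n)} (hy : y ∈ coordDomain n n f c c')
    (u : EuclideanSpace ℝ (Fin n)) :
    (show EuclideanSpace ℝ (Fin n) from
      mfderiv 𝓘(ℝ, EuclideanSpace ℝ (Fin n)) (𝓡 n) (extChartAt (𝓡 n) c').symm
        (coordMap n n f c c' y) (fderiv ℝ (coordMap n n f c c') y u)) =
      mfderiv (𝓡 n) (𝓡 n) f ((extChartAt (𝓡 n) c).symm y)
        (mfderiv 𝓘(ℝ, EuclideanSpace ℝ (Fin n)) (𝓡 n) (extChartAt (𝓡 n) c).symm y u) := by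
  obtain ⟨hy1, hy2⟩ := hy
  have ho := (isOpen_coordDomain (m := n) (n := n) hf.continuous c c').mem_nhds ⟨hy1, hy2⟩
  have hg : DifferentiableAt ℝ (coordMap n n f c c') y :=
    ((contDiffOn_coordMap hf c c').contDiffAt ho).differentiableAt (by simp)
  have hgt : coordMap n n f c c' y ∈ (extChartAt (𝓡 n) c').target :=
    (extChartAt (𝓡 n) c').map_source hy2
  have h1 : mfderiv 𝓘(ℝ, EuclideanSpace ℝ (Fin n)) (𝓡 n)
      ((extChartAt (𝓡 n) c').symm ∘ coordMap n n f c c') y =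
      (mfderiv 𝓘(ℝ, EuclideanSpace ℝ (Fin n)) (𝓡 n) (extChartAt (𝓡 n) c').symm
        (coordMap n n f c c' y)).comp (fderiv ℝ (coordMap n n f c c') y) := by
    rw [mfderiv_comp y (mdifferentiableAt_symm c' hgt) hg.mdifferentiableAt, mfderiv_eq_fderiv]
    rfl
  have h2 : mfderiv 𝓘(ℝ, EuclideanSpace ℝ (Fin n)) (𝓡 n)
      (f ∘ (extChartAt (𝓡 n) c).symm) y =
      (mfderiv (𝓡 n) (𝓡 n) f ((extChartAt (𝓡 n) c).symm y)).comp
        (mfderiv 𝓘(ℝ, EuclideanSpace ℝ (Fin n)) (𝓡 n) (extChartAt (𝓡 n) c).symm y) :=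
    mfderiv_comp y ((hf _).mdifferentiableAt (by simp)) (mdifferentiableAt_symm c hy1)
  have h3 : (extChartAt (𝓡 n) c').symm ∘ coordMap n n f c c' =ᶠ[𝓝 y]
      f ∘ (extChartAt (𝓡 n) c).symm := by
    filter_upwards [ho] with w hw
    exact (extChartAt (𝓡 n) c').left_inv hw.2
  have h4 := h3.mfderiv_eq (I := 𝓘(ℝ, EuclideanSpace ℝ (Fin n))) (I' := 𝓡 n)
  rw [h2] at h4
  exact DFunLike.congr_fun (h1.symm.trans h4) u

/-- The Jacobian determinant of an orientation-preserving map read in two charts has the sign by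
which the charts differ: `ε det = |det| ε'`. -/
theorem chartSign_mul_det {oM : ManifoldOrientation n M} {oN : ManifoldOrientation n N} {f : M → N}
    (hf : ContMDiff (𝓡 n) (𝓡 n) ∞ f) (hof : OrientationPreserving oM oN f) (c : M) (c' : N)
    {y : EuclideanSpace ℝ (Fin n)} (hy : y ∈ coordDomain n n f c c') :
    oM.chartSign c y * (fderiv ℝ (coordMap n n f c c') y).det =
      |(fderiv ℝ (coordMap n n f c c') y).det| * oN.chartSign c' (coordMap n n f c c' y) := by
  have hz : (extChartAt (𝓡 n) c').symm (coordMap n n f c c' y) = f ((extChartAt (𝓡 n) c).symm y) :=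
    (extChartAt (𝓡 n) c').left_inv hy.2
  have hgt : coordMap n n f c c' y ∈ (extChartAt (𝓡 n) c').target :=
    (extChartAt (𝓡 n) c').map_source hy.2
  -- All tangent spaces are the model space, so a frame may be moved along an equality of points.
  have h5 : ∀ (z z' : N) (_ : z = z') (w : Fin n → EuclideanSpace ℝ (Fin n)),
      frameSign (V := EuclideanSpace ℝ (Fin n)) (oN.orientationAt z) w =
        frameSign (V := EuclideanSpace ℝ (Fin n)) (oN.orientationAt z') w := by
    rintro z _ rfl w
    rfl
  have h6 : oM.chartSign c y = frameSign (V := EuclideanSpace ℝ (Fin n))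
      (oN.orientationAt ((extChartAt (𝓡 n) c').symm (coordMap n n f c c' y)))
      (fun i => mfderiv 𝓘(ℝ, EuclideanSpace ℝ (Fin n)) (𝓡 n) (extChartAt (𝓡 n) c').symm
        (coordMap n n f c c' y)
        (fderiv ℝ (coordMap n n f c c') y (EuclideanSpace.single i (1 : ℝ)))) := by
    refine Eq.trans ?_ (h5 _ _ hz _).symm
    have h7 := hof ((extChartAt (𝓡 n) c).symm y) (coordFrame n c y)
    refine (frameSign_congr h7).trans ?_
    refine congrArg (frameSign (V := EuclideanSpace ℝ (Fin n))
      (oN.orientationAt (f ((extChartAt (𝓡 n) c).symm y)))) ?_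
    funext i
    exact (mfderiv_symm_fderiv_coordMap hf c c' hy _).symm
  rw [h6]
  exact frameSign_mul_det _ (det_mfderiv_extChartAt_symm_ne_zero c' hgt) _

end ChartSign

/-! ### Integration in a chart and change of variables -/

section ChartIntegral

open MeasureTheory

variable {n : ℕ} {M : Type*} [TopologicalSpace M] [ChartedSpace (EuclideanSpace ℝ (Fin n)) M]
  {N : Type*} [TopologicalSpace N] [ChartedSpace (EuclideanSpace ℝ (Fin n)) N]

/-- The function integrated in the chart around `c` to compute `∫ f α`. -/
def chartIntegrand (o : ManifoldOrientation n M) (c : M) (f : M → ℝ) (α : Form n n M)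
    (y : EuclideanSpace ℝ (Fin n)) : ℝ :=
  f ((extChartAt (𝓡 n) c).symm y) *
    (o.chartSign c y * localRep α.1 c y (fun i => EuclideanSpace.single i (1 : ℝ)))

/-- The integral of `f α` over the domain of the chart around `c`, computed in that chart. -/
def chartIntegral (o : ManifoldOrientation n M) (c : M) (f : M → ℝ) (α : Form n n M) : ℝ :=
  ∫ y in (extChartAt (𝓡 n) c).target, chartIntegrand o c f α y

theorem chartIntegrand_eq_zero (o : ManifoldOrientation n M) (c : M) {f : M → ℝ} {α : Form n n M}
    {y : EuclideanSpace ℝ (Fin n)} (h : f ((extChartAt (𝓡 n) c).symm y) = 0 ∨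
      α.1 ((extChartAt (𝓡 n) c).symm y) = 0) : chartIntegrand o c f α y = 0 := by
  rcases h with h | h
  · rw [chartIntegrand, h, zero_mul]
  · simp [chartIntegrand, localRep_eq_zero h]

theorem isCompact_image_extChartAt [CompactSpace M] {c : M} {K : Set M} (hK : IsClosed K)
    (hKc : K ⊆ (chartAt (EuclideanSpace ℝ (Fin n)) c).source) :
    IsCompact (extChartAt (𝓡 n) c '' K) :=
  hK.isCompact.image_of_continuousOn
    ((continuousOn_extChartAt c).mono (by rwa [extChartAt_source]))

/-- The integrand is continuous on the target of the chart, and vanishes outside of a compact subset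
of it if `f α` is supported in a closed subset `K` of the domain of the chart. -/
theorem integrableOn_chartIntegrand [CompactSpace M] (o : ManifoldOrientation n M) (c : M)
    {f : M → ℝ} (hf : Continuous f) (α : Form n n M) {K : Set M} (hK : IsClosed K)
    (hKc : K ⊆ (chartAt (EuclideanSpace ℝ (Fin n)) c).source)
    (h0 : ∀ x ∉ K, f x = 0 ∨ α.1 x = 0) :
    IntegrableOn (chartIntegrand o c f α) (extChartAt (𝓡 n) c).target := by
  have hcont : ContinuousOn (chartIntegrand o c f α) (extChartAt (𝓡 n) c).target := by
    refine (hf.comp_continuousOn (continuousOn_extChartAt_symm c)).mul (ContinuousOn.mul ?_ ?_)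
    · intro y hy
      refine ContinuousAt.continuousWithinAt ?_
      exact continuousAt_const.congr
        ((chartSign_eventuallyEq o c hy).mono fun _ h => h.symm)
    · exact (contDiffOn_alternating_iff.1 (α.smooth c) _).continuousOn
  have hK' := isCompact_image_extChartAt (n := n) hK hKc
  have hsub : extChartAt (𝓡 n) c '' K ⊆ (extChartAt (𝓡 n) c).target := by
    rintro _ ⟨x, hx, rfl⟩
    exact (extChartAt (𝓡 n) c).map_source (by rw [extChartAt_source]; exact hKc hx)
  refine IntegrableOn.of_forall_sdiff_eq_zero ((hcont.mono hsub).integrableOn_compact hK')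
    (isOpen_extChartAt_target c).measurableSet fun y hy => ?_
  refine chartIntegrand_eq_zero o c (h0 _ fun hxK => hy.2 ⟨_, hxK, ?_⟩)
  exact (extChartAt (𝓡 n) c).right_inv hy.1

theorem chartIntegral_sum {ι : Type*} (T : Finset ι) (o : ManifoldOrientation n M) (c : M)
    (f : ι → M → ℝ) (g : M → ℝ) (hg : ∀ x, g x = ∑ d ∈ T, f d x) (α : Form n n M)
    (h : ∀ d ∈ T, IntegrableOn (chartIntegrand o c (f d) α) (extChartAt (𝓡 n) c).target) :
    chartIntegral o c g α = ∑ d ∈ T, chartIntegral o c (f d) α := by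
  simp only [chartIntegral]
  rw [← integral_finsetSum _ h]
  congr 1
  funext y
  simp only [chartIntegrand, hg, Finset.sum_mul]

theorem image_coordMap_coordDomain (φ : M ≃ₘ^∞⟮𝓡 n, 𝓡 n⟯ N) (c : M) (c' : N) :
    coordMap n n φ c c' '' coordDomain n n φ c c' = coordDomain n n φ.symm c' c := by
  have key : ∀ z ∈ coordDomain n n φ.symm c' c,
      coordMap n n φ.symm c' c z ∈ coordDomain n n φ c c' ∧
        coordMap n n φ c c' (coordMap n n φ.symm c' c z) = z := by
    intro z hz
    have e1 : (extChartAt (𝓡 n) c).symm (coordMap n n φ.symm c' c z) =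
        φ.symm ((extChartAt (𝓡 n) c').symm z) := (extChartAt (𝓡 n) c).left_inv hz.2
    have e2 : φ ((extChartAt (𝓡 n) c).symm (coordMap n n φ.symm c' c z)) =
        (extChartAt (𝓡 n) c').symm z := by rw [e1, φ.apply_symm_apply]
    refine ⟨⟨(extChartAt (𝓡 n) c).map_source hz.2, ?_⟩, ?_⟩
    · show φ _ ∈ (extChartAt (𝓡 n) c').source
      rw [e2]
      exact (extChartAt (𝓡 n) c').map_target hz.1
    · show extChartAt (𝓡 n) c' (φ _) = z
      rw [e2]
      exact (extChartAt (𝓡 n) c').right_inv hz.1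
  ext z
  constructor
  · rintro ⟨y, hy, rfl⟩
    have e1 : (extChartAt (𝓡 n) c').symm (coordMap n n φ c c' y) =
        φ ((extChartAt (𝓡 n) c).symm y) := (extChartAt (𝓡 n) c').left_inv hy.2
    refine ⟨(extChartAt (𝓡 n) c').map_source hy.2, ?_⟩
    show φ.symm _ ∈ (extChartAt (𝓡 n) c).source
    rw [e1, φ.symm_apply_apply]
    exact (extChartAt (𝓡 n) c).map_target hy.1
  · exact fun hz => ⟨_, (key z hz).1, (key z hz).2⟩

theorem injOn_coordMap (φ : M ≃ₘ^∞⟮𝓡 n, 𝓡 n⟯ N) (c : M) (c' : N) :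
    Set.InjOn (coordMap n n φ c c') (coordDomain n n φ c c') := by
  intro y hy z hz h
  have h1 := φ.injective ((extChartAt (𝓡 n) c').injOn hy.2 hz.2 h)
  exact (extChartAt (𝓡 n) c).symm.injOn hy.1 hz.1 h1

theorem orientationPreserving_refl (o : ManifoldOrientation n M) :
    OrientationPreserving o o (Diffeomorph.refl (𝓡 n) M ∞) := by
  intro x v
  have h : (fun i => mfderiv (𝓡 n) (𝓡 n) (Diffeomorph.refl (𝓡 n) M ∞) x (v i)) = v := by
    funext i
    rw [Diffeomorph.coe_refl, mfderiv_id]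
    rfl
  exact iff_of_eq (congrArg (IsPositiveFrame (o.orientationAt x)) h.symm)

variable [IsManifold (𝓡 n) ∞ M] [IsManifold (𝓡 n) ∞ N]

/-- The integrand of the pullback is the integrand multiplied by the absolute Jacobian. -/
theorem chartIntegrand_pullback {oM : ManifoldOrientation n M} {oN : ManifoldOrientation n N}
    {φ : M → N} (hφ : ContMDiff (𝓡 n) (𝓡 n) ∞ φ)
    (hoφ : OrientationPreserving oM oN φ) (c : M) (c' : N) (f : N → ℝ) (β : Form n n N)
    {y : EuclideanSpace ℝ (Fin n)} (hy : y ∈ coordDomain n n φ c c') :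
    chartIntegrand oM c (f ∘ φ) (pullback φ hφ β) y =
      |(fderiv ℝ (coordMap n n φ c c') y).det| •
        chartIntegrand oN c' f β (coordMap n n φ c c' y) := by
  have hz : (extChartAt (𝓡 n) c').symm (coordMap n n φ c c' y) = φ ((extChartAt (𝓡 n) c).symm y) :=
    (extChartAt (𝓡 n) c').left_inv hy.2
  have h1 : localRep (pullback φ hφ β).1 c y (fun i => EuclideanSpace.single i (1 : ℝ)) =
      (fderiv ℝ (coordMap n n φ c c') y).det *
        localRep β.1 c' (coordMap n n φ c c' y) (fun i => EuclideanSpace.single i (1 : ℝ)) :=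
    (DFunLike.congr_fun (localRep_pullbackField hφ β.1 c c' hy) _).trans
      (alternating_apply_comp_single
        (localRep β.1 c' (coordMap n n φ c c' y)).toAlternatingMap _)
  have h2 := chartSign_mul_det hφ hoφ c c' hy
  simp only [chartIntegrand, Function.comp_apply, hz, h1, smul_eq_mul]
  rw [← mul_assoc (oM.chartSign c y), h2]
  ring

/-- Change of variables: if `f β` vanishes outside of the part of `N` seen by both charts, then
its integral in the chart around `c'` is the integral of its pullback in the chart around `c`. -/
theorem chartIntegral_pullback {oM : ManifoldOrientation n M} {oN : ManifoldOrientation n N}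
    (φ : M ≃ₘ^∞⟮𝓡 n, 𝓡 n⟯ N) (hoφ : OrientationPreserving oM oN φ) (c : M) (c' : N) (f : N → ℝ)
    (β : Form n n N)
    (h : ∀ x, x ∈ (extChartAt (𝓡 n) c').source ∧ φ.symm x ∈ (extChartAt (𝓡 n) c).source ∨
      f x = 0 ∨ β.1 x = 0) :
    chartIntegral oM c (f ∘ φ) (pullback φ φ.contMDiff β) = chartIntegral oN c' f β := by
  have ho := isOpen_coordDomain (m := n) (n := n) φ.continuous c c'
  have h1 : chartIntegral oM c (f ∘ φ) (pullback φ φ.contMDiff β) =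
      ∫ y in coordDomain n n φ c c', chartIntegrand oM c (f ∘ φ) (pullback φ φ.contMDiff β) y := by
    refine (setIntegral_eq_of_subset_of_forall_sdiff_eq_zero
      (isOpen_extChartAt_target c).measurableSet Set.inter_subset_left fun y hy => ?_)
    refine chartIntegrand_eq_zero _ _ ?_
    rcases h (φ ((extChartAt (𝓡 n) c).symm y)) with hs | h0 | h0
    · exact absurd ⟨hy.1, hs.1⟩ hy.2
    · exact Or.inl h0
    · refine Or.inr ?_
      show (β.1 (φ _)).compContinuousLinearMap _ = 0
      rw [h0]
      rfl
  have h2 : chartIntegral oN c' f β =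
      ∫ y in coordDomain n n φ.symm c' c, chartIntegrand oN c' f β y := by
    refine (setIntegral_eq_of_subset_of_forall_sdiff_eq_zero
      (isOpen_extChartAt_target c').measurableSet Set.inter_subset_left fun y hy => ?_)
    refine chartIntegrand_eq_zero _ _ ?_
    rcases h ((extChartAt (𝓡 n) c').symm y) with hs | h0
    · exact absurd ⟨hy.1, hs.2⟩ hy.2
    · exact h0
  rw [h1, h2, ← image_coordMap_coordDomain, integral_image_eq_integral_abs_det_fderiv_smul volume
    ho.measurableSet (fun y hy => (((contDiffOn_coordMap φ.contMDiff c c').contDiffAt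
      (ho.mem_nhds hy)).differentiableAt (by simp)).hasFDerivAt.hasFDerivWithinAt)
    (injOn_coordMap φ c c')]
  exact setIntegral_congr_fun ho.measurableSet fun y hy =>
    chartIntegrand_pullback φ.contMDiff hoφ c c' f β hy

/-- The integral of `f α` is the same in two charts whose domains contain its support. -/
theorem chartIntegral_eq_of_charts (o : ManifoldOrientation n M) (c c' : M) (f : M → ℝ)
    (α : Form n n M)
    (h : ∀ x, x ∈ (extChartAt (𝓡 n) c').source ∧ x ∈ (extChartAt (𝓡 n) c).source ∨
      f x = 0 ∨ α.1 x = 0) :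
    chartIntegral o c f α = chartIntegral o c' f α := by
  have h1 := chartIntegral_pullback (Diffeomorph.refl (𝓡 n) M ∞) (orientationPreserving_refl o)
    c c' f α h
  have h2 : pullback (Diffeomorph.refl (𝓡 n) M ∞) (Diffeomorph.contMDiff _) α = α :=
    Subtype.ext (pullbackField_id α.1)
  rw [h2] at h1
  exact h1

end ChartIntegral

/-! ### The integral over a compact oriented manifold -/

section Integral

open MeasureTheory

variable {n : ℕ} {M : Type*} [TopologicalSpace M] [ChartedSpace (EuclideanSpace ℝ (Fin n)) M]
  [IsManifold (𝓡 n) ∞ M] [T2Space M] [CompactSpace M]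
  {N : Type*} [TopologicalSpace N] [ChartedSpace (EuclideanSpace ℝ (Fin n)) N]
  [IsManifold (𝓡 n) ∞ N] [T2Space N] [CompactSpace N]

theorem tsupport_chartPartition_subset (c : M) :
    tsupport (chartPartition n M c) ⊆ (chartAt (EuclideanSpace ℝ (Fin n)) c).source :=
  (SmoothPartitionOfUnity.exists_isSubordinate_chartAt_source (𝓡 n) M).choose_spec c

theorem chartPartition_eq_zero {c x : M} (h : x ∉ tsupport (chartPartition n M c)) :
    chartPartition n M c x = 0 :=
  image_eq_zero_of_notMem_tsupport h

variable (n M) in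
theorem finite_chartPartition :
    {c : M | (Function.support (chartPartition n M c)).Nonempty}.Finite :=
  (chartPartition n M).locallyFinite.finite_nonempty_of_compact

variable (n M) in
/-- The finitely many indices `c` for which `ρ_c` is not identically zero. -/
def activeCharts : Finset M := (finite_chartPartition n M).toFinset

theorem chartPartition_eq_zero_of_notMem {c : M} (h : c ∉ activeCharts n M) (x : M) :
    chartPartition n M c x = 0 := by
  by_contra hx
  exact h ((finite_chartPartition n M).mem_toFinset.2 ⟨x, hx⟩)

variable (n) in
theorem sum_chartPartition (x : M) : ∑ c ∈ activeCharts n M, chartPartition n M c x = 1 := by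
  rw [← (chartPartition n M).sum_eq_one (Set.mem_univ x)]
  refine (finsum_eq_sum_of_support_subset _ fun c hc => ?_).symm
  by_contra h
  exact hc (chartPartition_eq_zero_of_notMem h x)

theorem integral_eq_sum (o : ManifoldOrientation n M) (α : Form n n M) :
    integral o α = ∑ c ∈ activeCharts n M, chartIntegral o c (chartPartition n M c) α := by
  refine finsum_eq_sum_of_support_subset _ fun c hc => ?_
  by_contra h
  refine hc ?_
  have h0 : ∀ y, chartIntegrand o c (chartPartition n M c) α y = 0 := fun y =>
    chartIntegrand_eq_zero o c (Or.inl (chartPartition_eq_zero_of_notMem h _))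
  show chartIntegral o c (chartPartition n M c) α = 0
  simp [chartIntegral, h0]

theorem integrableOn_chartPartition (o : ManifoldOrientation n M) (c : M) (α : Form n n M) :
    IntegrableOn (chartIntegrand o c (chartPartition n M c) α) (extChartAt (𝓡 n) c).target :=
  integrableOn_chartIntegrand o c (chartPartition n M c).contMDiff.continuous α
    (isClosed_tsupport _) (tsupport_chartPartition_subset c)
    fun _ hx => Or.inl (chartPartition_eq_zero hx)

theorem integral_add (o : ManifoldOrientation n M) (α β : Form n n M) :
    integral o (α + β) = integral o α + integral o β := by
  simp only [integral_eq_sum, ← Finset.sum_add_distrib]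
  refine Finset.sum_congr rfl fun c _ => ?_
  simp only [chartIntegral]
  rw [← MeasureTheory.integral_add (integrableOn_chartPartition o c α)
    (integrableOn_chartPartition o c β)]
  congr 1
  funext y
  have h : localRep (α + β).1 c y = localRep α.1 c y + localRep β.1 c y := rfl
  simp only [chartIntegrand, h, ContinuousAlternatingMap.add_apply]
  ring

theorem integral_smul (o : ManifoldOrientation n M) (t : ℝ) (α : Form n n M) :
    integral o (t • α) = t * integral o α := by
  simp only [integral_eq_sum, Finset.mul_sum]
  refine Finset.sum_congr rfl fun c _ => ?_
  simp only [chartIntegral]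
  rw [← integral_const_mul]
  congr 1
  funext y
  have h : localRep (t • α).1 c y = t • localRep α.1 c y := rfl
  simp only [chartIntegrand, h, ContinuousAlternatingMap.smul_apply, smul_eq_mul]
  ring

/-- The integral as a linear functional. -/
def integralLM (o : ManifoldOrientation n M) : Form n n M →ₗ[ℝ] ℝ where
  toFun := integral o
  map_add' := integral_add o
  map_smul' := integral_smul o

/-- Invariance of the integral. Both sides are the sum, over the charts `c` of `M` and `d` of `N`,
of the integrals of `(ρ_c ∘ φ⁻¹) ρ_d β`, which may be computed in either chart. -/
theorem integral_pullback {oM : ManifoldOrientation n M} {oN : ManifoldOrientation n N}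
    (φ : M ≃ₘ^∞⟮𝓡 n, 𝓡 n⟯ N) (hoφ : OrientationPreserving oM oN φ) (β : Form n n N) :
    integral oM (pullback φ φ.contMDiff β) = integral oN β := by
  let F : M → N → N → ℝ := fun c d x => chartPartition n M c (φ.symm x) * chartPartition n N d x
  have hF : ∀ c d, Continuous (F c d) := fun c d =>
    ((chartPartition n M c).contMDiff.continuous.comp φ.symm.continuous).mul
      (chartPartition n N d).contMDiff.continuous
  have h1 : ∀ c, chartIntegral oM c (chartPartition n M c) (pullback φ φ.contMDiff β) =
      ∑ d ∈ activeCharts n N, chartIntegral oM c (F c d ∘ φ) (pullback φ φ.contMDiff β) := by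
    intro c
    refine chartIntegral_sum _ oM c _ _ (fun x => ?_) _ fun d _ => ?_
    · simp only [F, Function.comp_apply, φ.symm_apply_apply, ← Finset.mul_sum,
        sum_chartPartition, mul_one]
    · refine integrableOn_chartIntegrand oM c ((hF c d).comp φ.continuous) _ (isClosed_tsupport _)
        (tsupport_chartPartition_subset c) fun x hx => Or.inl ?_
      simp only [F, Function.comp_apply, φ.symm_apply_apply, chartPartition_eq_zero hx, zero_mul]
  have h2 : ∀ d, chartIntegral oN d (chartPartition n N d) β =
      ∑ c ∈ activeCharts n M, chartIntegral oN d (F c d) β := by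
    intro d
    refine chartIntegral_sum _ oN d _ _ (fun x => ?_) _ fun c _ => ?_
    · simp only [F, ← Finset.sum_mul, sum_chartPartition, one_mul]
    · refine integrableOn_chartIntegrand oN d (hF c d) _ (isClosed_tsupport _)
        (tsupport_chartPartition_subset d) fun x hx => Or.inl ?_
      simp only [F, chartPartition_eq_zero hx, mul_zero]
  rw [integral_eq_sum, integral_eq_sum]
  simp only [h1, h2]
  rw [Finset.sum_comm]
  refine Finset.sum_congr rfl fun d _ => Finset.sum_congr rfl fun c _ => ?_
  refine chartIntegral_pullback φ hoφ c d (F c d) β fun x => ?_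
  by_cases hx : x ∈ tsupport (chartPartition n N d)
  · by_cases hx' : φ.symm x ∈ tsupport (chartPartition n M c)
    · refine Or.inl ⟨?_, ?_⟩
      · rw [extChartAt_source]; exact tsupport_chartPartition_subset d hx
      · rw [extChartAt_source]; exact tsupport_chartPartition_subset c hx'
    · exact Or.inr (Or.inl (by simp only [F, chartPartition_eq_zero hx', zero_mul]))
  · exact Or.inr (Or.inl (by simp only [F, chartPartition_eq_zero hx, mul_zero]))

/-- A form supported in the domain of one chart may be integrated in this chart. -/
theorem integral_eq_chartIntegral (o : ManifoldOrientation n M) (α : Form n n M) (c : M) {K : Set M}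
    (hK : IsClosed K) (hKc : K ⊆ (chartAt (EuclideanSpace ℝ (Fin n)) c).source)
    (h0 : ∀ x ∉ K, α.1 x = 0) : integral o α = chartIntegral o c 1 α := by
  rw [integral_eq_sum, chartIntegral_sum (activeCharts n M) o c
    (fun d => (chartPartition n M d : M → ℝ)) 1 (fun x => (sum_chartPartition n x).symm) α
    fun d _ => integrableOn_chartIntegrand o c (chartPartition n M d).contMDiff.continuous α hK hKc
      fun x hx => Or.inr (h0 x hx)]
  refine Finset.sum_congr rfl fun d _ => chartIntegral_eq_of_charts o d c _ α fun x => ?_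
  by_cases hx : x ∈ tsupport (chartPartition n M d)
  · by_cases hx' : x ∈ K
    · refine Or.inl ⟨?_, ?_⟩
      · rw [extChartAt_source]; exact hKc hx'
      · rw [extChartAt_source]; exact tsupport_chartPartition_subset d hx
    · exact Or.inr (Or.inr (h0 x hx'))
  · exact Or.inr (Or.inl (chartPartition_eq_zero hx))

end Integral

/-! ### Stokes' theorem on Euclidean space, and supports of forms -/

section Stokes

open MeasureTheory

/-- Stokes' theorem for compactly supported forms on `ℝ^{r+1}`. -/
theorem integral_extDeriv_eq_zero {r : ℕ}
    {G : EuclideanSpace ℝ (Fin (r + 1)) → EuclideanSpace ℝ (Fin (r + 1)) [⋀^Fin r]→L[ℝ] ℝ}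
    (hG : ContDiff ℝ ∞ G) (hc : HasCompactSupport G)
    (v : Fin (r + 1) → EuclideanSpace ℝ (Fin (r + 1))) :
    ∫ y, extDeriv G y v = 0 := by
  have hd : ∀ y, DifferentiableAt ℝ G y := fun y => hG.contDiffAt.differentiableAt (by simp)
  have hg : ∀ w, ContDiff ℝ ∞ (fun y => G y w) := fun w =>
    (ContinuousAlternatingMap.apply ℝ _ ℝ w).contDiff.comp hG
  have hgc : ∀ w, HasCompactSupport (fun y => G y w) := fun w =>
    hc.comp_left (g := fun a : EuclideanSpace ℝ (Fin (r + 1)) [⋀^Fin r]→L[ℝ] ℝ => a w) rfl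
  have hint : ∀ w u, Integrable (fun y => fderiv ℝ (fun y => G y w) y u) := fun w u =>
    (((hg w).continuous_fderiv (by simp)).clm_apply continuous_const).integrable_of_hasCompactSupport
      ((hgc w).fderiv_apply ℝ u)
  have hzero : ∀ w u, ∫ y, fderiv ℝ (fun y => G y w) y u = 0 := by
    intro w u
    -- Integration by parts against the constant function `1`.
    have h := integral_mul_fderiv_eq_neg_fderiv_mul_of_integrable (μ := volume) (𝕜 := ℝ)
      (f := fun _ => (1 : ℝ)) (g := fun y => G y w) (v := u) (by simp) (by simpa using hint w u)
      (by simpa using (hg w).continuous.integrable_of_hasCompactSupport (hgc w))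
      (fun y _ => differentiableAt_const _)
      (fun y _ => (hg w).contDiffAt.differentiableAt (by simp))
    simpa using h
  simp only [extDeriv_apply (hd _), zsmul_eq_mul]
  rw [integral_finsetSum _ fun i _ => (hint _ _).const_mul _]
  refine Finset.sum_eq_zero fun i _ => ?_
  rw [integral_const_mul, hzero, mul_zero]

variable {n p : ℕ} {M : Type*} [TopologicalSpace M] [ChartedSpace (EuclideanSpace ℝ (Fin n)) M]

theorem localRep_eventuallyEq_zero {α : Form n p M} {K : Set M} (hK : IsClosed K)
    (h0 : ∀ x ∉ K, α.1 x = 0) (c : M) {y : EuclideanSpace ℝ (Fin n)}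
    (hy : y ∈ (extChartAt (𝓡 n) c).target) (hyK : (extChartAt (𝓡 n) c).symm y ∉ K) :
    ∀ᶠ z in 𝓝 y, localRep α.1 c z = 0 := by
  have ho := (continuousOn_extChartAt_symm (I := 𝓡 n) c).isOpen_inter_preimage
    (isOpen_extChartAt_target c) hK.isOpen_compl
  filter_upwards [ho.mem_nhds ⟨hy, hyK⟩] with z hz
  exact localRep_eq_zero (h0 _ hz.2)

variable [IsManifold (𝓡 n) ∞ M]

/-- The product of a smooth function and a form. -/
def functionSMul (f : M → ℝ) (hf : ContMDiff (𝓡 n) 𝓘(ℝ) ∞ f) (α : Form n p M) : Form n p M :=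
  ⟨fun x => f x • α.1 x, fun c => by
    have h1 : ContDiffOn ℝ ∞ (f ∘ (extChartAt (𝓡 n) c).symm) (extChartAt (𝓡 n) c).target :=
      (hf.comp_contMDiffOn (contMDiffOn_extChartAt_symm c)).contDiffOn
    exact h1.smul (α.smooth c)⟩

/-- The exterior derivative does not increase supports. -/
theorem extD_eq_zero_of_notMem {α : Form n p M} {K : Set M} (hK : IsClosed K)
    (h0 : ∀ x ∉ K, α.1 x = 0) {x : M} (hx : x ∉ K) : (extD α).1 x = 0 := by
  have h1 : localRep α.1 x =ᶠ[𝓝 (extChartAt (𝓡 n) x x)] 0 :=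
    localRep_eventuallyEq_zero hK h0 x (mem_extChartAt_target x)
      (by rwa [extChartAt_to_inv x])
  have h2 : _root_.extDeriv (localRep α.1 x) (extChartAt (𝓡 n) x x) = 0 := by
    rw [h1.extDeriv_eq, _root_.extDeriv]
    ext v
    simp [ContinuousAlternatingMap.alternatizeUncurryFin_apply]
  show (_root_.extDeriv (localRep α.1 x) (extChartAt (𝓡 n) x x)).compContinuousLinearMap _ = 0
  rw [h2]
  rfl

end Stokes

/-! ### Stokes' theorem on a compact manifold -/

section StokesManifold

open MeasureTheory

variable {r : ℕ} {M : Type*} [TopologicalSpace M]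
  [ChartedSpace (EuclideanSpace ℝ (Fin (r + 1))) M] [IsManifold (𝓡 (r + 1)) ∞ M] [CompactSpace M]

/-- Stokes' theorem for a form supported in the domain of a chart. The sign of the chart is locally
constant, so the coordinate expression multiplied by the sign is still smooth. -/
theorem chartIntegral_extD_eq_zero [T2Space M] (o : ManifoldOrientation (r + 1) M) (c : M)
    (α : Form (r + 1) r M) {K : Set M} (hK : IsClosed K)
    (hKc : K ⊆ (chartAt (EuclideanSpace ℝ (Fin (r + 1))) c).source) (h0 : ∀ x ∉ K, α.1 x = 0) :
    chartIntegral o c 1 (extD α) = 0 := by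
  classical
  let U := (extChartAt (𝓡 (r + 1)) c).target
  have hU : IsOpen U := isOpen_extChartAt_target c
  -- The coordinate expression of `α`, with the sign of the chart, extended by zero.
  let G : EuclideanSpace ℝ (Fin (r + 1)) → EuclideanSpace ℝ (Fin (r + 1)) [⋀^Fin r]→L[ℝ] ℝ :=
    U.indicator fun y => o.chartSign c y • localRep α.1 c y
  have hK' := isCompact_image_extChartAt (n := r + 1) hK hKc
  have hloc : ∀ y ∈ U, G =ᶠ[𝓝 y] o.chartSign c y • localRep α.1 c := by
    intro y hy
    filter_upwards [hU.mem_nhds hy, chartSign_eventuallyEq o c hy] with z hz hs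
    simp only [G, Set.indicator_of_mem hz, hs, Pi.smul_apply]
  have hGK : ∀ y ∉ extChartAt (𝓡 (r + 1)) c '' K, G y = 0 := by
    intro y hy
    by_cases hyU : y ∈ U
    · have : localRep α.1 c y = 0 := localRep_eq_zero (h0 _ fun hx =>
        hy ⟨_, hx, (extChartAt (𝓡 (r + 1)) c).right_inv hyU⟩)
      simp only [G, Set.indicator_of_mem hyU, this, smul_zero]
    · exact Set.indicator_of_notMem hyU _
  have hGs : ContDiff ℝ ∞ G := by
    refine contDiff_iff_contDiffAt.2 fun y => ?_
    by_cases hyU : y ∈ U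
    · exact (contDiffAt_const.smul ((α.smooth c).contDiffAt (hU.mem_nhds hyU))).congr_of_eventuallyEq
        (hloc y hyU)
    · have hy : y ∉ extChartAt (𝓡 (r + 1)) c '' K := by
        rintro ⟨x, hx, rfl⟩
        exact hyU ((extChartAt (𝓡 (r + 1)) c).map_source (by rw [extChartAt_source]; exact hKc hx))
      have : G =ᶠ[𝓝 y] fun _ => 0 := by
        filter_upwards [hK'.isClosed.isOpen_compl.mem_nhds hy] with z hz using hGK z hz
      exact contDiffAt_const.congr_of_eventuallyEq this
  have hGc : HasCompactSupport G := HasCompactSupport.intro hK' hGK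
  have hval : ∀ y ∈ U, chartIntegrand o c 1 (extD α) y =
      _root_.extDeriv G y (fun i => EuclideanSpace.single i (1 : ℝ)) := by
    intro y hy
    have e : localRep (extD α).1 c y = _root_.extDeriv (localRep α.1 c) y :=
      localRep_extDerivField α.smooth c hy
    rw [(hloc y hy).extDeriv_eq, extDeriv_smul, chartIntegrand, e]
    simp
  have hout : ∀ y ∉ U, _root_.extDeriv G y (fun i => EuclideanSpace.single i (1 : ℝ)) = 0 := by
    intro y hyU
    have hy : y ∉ tsupport G := fun h => hyU (by
      have h1 : tsupport G ⊆ extChartAt (𝓡 (r + 1)) c '' K :=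
        closure_minimal (fun z hz => by_contra fun h => hz (hGK z h)) hK'.isClosed
      obtain ⟨x, hx, rfl⟩ := h1 h
      exact (extChartAt (𝓡 (r + 1)) c).map_source (by rw [extChartAt_source]; exact hKc hx))
    have h2 : G =ᶠ[𝓝 y] 0 := notMem_tsupport_iff_eventuallyEq.1 hy
    rw [h2.extDeriv_eq, _root_.extDeriv]
    simp [ContinuousAlternatingMap.alternatizeUncurryFin_apply]
  rw [chartIntegral, setIntegral_congr_fun hU.measurableSet hval,
    setIntegral_eq_integral_of_forall_compl_eq_zero hout]
  exact integral_extDeriv_eq_zero hGs hGc _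

variable [T2Space M]

/-- Stokes' theorem on a compact manifold without boundary: exact forms have integral zero. By a
partition of unity it suffices to consider forms supported in the domain of one chart. -/
theorem integral_extD_eq_zero (o : ManifoldOrientation (r + 1) M) (η : Form (r + 1) r M) :
    integral o (extD η) = 0 := by
  let ηc : M → Form (r + 1) r M := fun c =>
    functionSMul (chartPartition (r + 1) M c) (chartPartition (r + 1) M c).contMDiff η
  have hsum : η = ∑ c ∈ activeCharts (r + 1) M, ηc c := by
    refine Subtype.ext (funext fun x => ?_)
    have h1 : (∑ c ∈ activeCharts (r + 1) M, ηc c).1 =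
        ∑ c ∈ activeCharts (r + 1) M, (ηc c).1 :=
      map_sum (smoothForms (r + 1) r M).subtype ηc _
    have h2 : (∑ c ∈ activeCharts (r + 1) M, ηc c).1 x =
        (∑ c ∈ activeCharts (r + 1) M, chartPartition (r + 1) M c x) • η.1 x := by
      rw [h1, Finset.sum_apply, Finset.sum_smul]
      rfl
    rw [h2, sum_chartPartition, one_smul]
  rw [hsum, map_sum]
  refine (map_sum (integralLM o) _ _).trans (Finset.sum_eq_zero fun c _ => ?_)
  have h0 : ∀ x ∉ tsupport (chartPartition (r + 1) M c), (ηc c).1 x = 0 := fun x hx => by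
    show (chartPartition (r + 1) M c x) • η.1 x = 0
    rw [chartPartition_eq_zero hx, zero_smul]
  show integral o (extD (ηc c)) = 0
  rw [integral_eq_chartIntegral o _ c (isClosed_tsupport _) (tsupport_chartPartition_subset c)
    fun x hx => extD_eq_zero_of_notMem (isClosed_tsupport _) h0 hx]
  exact chartIntegral_extD_eq_zero o c _ (isClosed_tsupport _) (tsupport_chartPartition_subset c) h0

end StokesManifold

section ExactWedge

variable {n p q : ℕ} {M : Type*} [TopologicalSpace M] [ChartedSpace (EuclideanSpace ℝ (Fin n)) M]
  [IsManifold (𝓡 n) ∞ M] [T2Space M] [CompactSpace M]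

/-- For `α = dτ` and closed `β`, the form `α ∧ β = d(τ ∧ β)` is exact. In degree `0` the only exact
form is `0`. -/
theorem integral_wedge_eq_zero_of_exact (o : ManifoldOrientation n M) (h : p + q = n)
    {α : Form n p M} (hα : α ∈ exactForms n M p) {β : Form n q M} (hβ : β ∈ closedForms n q M) :
    integral o (wedge h α β) = 0 := by
  cases p with
  | zero =>
    have h0 : α = 0 := hα
    rw [h0, wedge_zero_left]
    exact map_zero (integralLM o)
  | succ p =>
    obtain ⟨τ, rfl⟩ := hα
    obtain rfl : n = p + q + 1 := by omega
    rw [← extD_wedge_of_closed rfl h τ hβ]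
    exact integral_extD_eq_zero o _

end ExactWedge

/-! ### The signature of a symmetric matrix -/

section MatrixSignature

open QuadraticMap QuadraticForm

/-- The signature of the matrix of a symmetric bilinear form is that of the form: an orthonormal
basis of eigenvectors of the matrix diagonalizes the form, with the eigenvalues on the diagonal, and
Sylvester's law of inertia applies. -/
theorem matrixSignature_eq_sigPos_sub_sigNeg {V : Type*} [AddCommGroup V] [Module ℝ V]
    (B : LinearMap.BilinForm ℝ V) (hB : ∀ x y, B x y = B y x) {s : ℕ}
    (b : Module.Basis (Fin s) ℝ V) :
    matrixSignature (Matrix.of fun i j => B (b i) (b j)) =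
      (sigPos (LinearMap.BilinMap.toQuadraticMap B) : ℤ) -
        sigNeg (LinearMap.BilinMap.toQuadraticMap B) := by
  let A : Matrix (Fin s) (Fin s) ℝ := Matrix.of fun i j => B (b i) (b j)
  have hA : A.IsHermitian := by
    ext i j
    exact hB _ _
  have hAB : LinearMap.BilinForm.toMatrix b B = A := by
    ext i j
    simp [A, LinearMap.BilinForm.toMatrix_apply]
  let v : Module.Basis (Fin s) ℝ V := hA.eigenvectorBasis.toBasis.map
    ((WithLp.linearEquiv 2 ℝ (Fin s → ℝ)).trans b.equivFun.symm)
  have hrepr : ∀ i, (b.repr (v i) : Fin s → ℝ) = WithLp.ofLp (hA.eigenvectorBasis i) := by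
    intro i
    have : v i = b.equivFun.symm (WithLp.ofLp (hA.eigenvectorBasis i)) := by simp [v]
    rw [this, ← Module.Basis.equivFun_apply, LinearEquiv.apply_symm_apply]
  have hv : ∀ i j, B (v i) (v j) = if i = j then hA.eigenvalues i else 0 := by
    intro i j
    rw [LinearMap.BilinForm.apply_eq_dotProduct_toMatrix_mulVec b, hAB, hrepr, hrepr,
      hA.mulVec_eigenvectorBasis, dotProduct_smul]
    have h1 := orthonormal_iff_ite.1 hA.eigenvectorBasis.orthonormal j i
    rw [EuclideanSpace.inner_eq_star_dotProduct] at h1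
    simp only [star_trivial] at h1
    rw [h1]
    by_cases hij : i = j
    · subst hij; simp
    · simp [hij, Ne.symm hij]
  have hequiv : (LinearMap.BilinMap.toQuadraticMap B).Equivalent
      (weightedSumSquares ℝ hA.eigenvalues) := by
    -- The eigenvectors are orthogonal for `B` as well as for the Euclidean inner product.
    have h1 := basisRepr_eq_of_iIsOrtho (R := ℝ) (LinearMap.BilinMap.toQuadraticMap B) v (by
      intro i j hij
      have h2 := hv i j
      have h3 := hv j i
      rw [if_neg hij] at h2
      rw [if_neg hij.symm] at h3
      simp [Function.onFun, h2, h3, QuadraticMap.associated_apply])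
    have h2 : (fun i => LinearMap.BilinMap.toQuadraticMap B (v i)) = hA.eigenvalues := by
      funext i
      simpa using hv i i
    rw [h2] at h1
    rw [← h1]
    exact ⟨isometryEquivBasisRepr _ v⟩
  have hcount : ∀ (P : ℝ → Prop) [DecidablePred P],
      A.charpoly.roots.countP P = {i | P (hA.eigenvalues i)}.ncard := by
    intro P _
    rw [hA.roots_charpoly_eq_eigenvalues, Multiset.countP_map, Set.ncard_eq_toFinset_card']
    simp [Finset.card, Finset.filter]
  show (A.charpoly.roots.countP (fun t => 0 < t) : ℤ) - (A.charpoly.roots.countP (fun t => t < 0) : ℤ)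
    = _
  rw [hcount, hcount, sigPos_of_equiv_weightedSumSquares hequiv,
    sigNeg_of_equiv_weightedSumSquares hequiv]

end MatrixSignature

/-! ### Functoriality of de Rham cohomology -/

section Functoriality

variable {n m p : ℕ} {M : Type*} [TopologicalSpace M] [ChartedSpace (EuclideanSpace ℝ (Fin n)) M]
  [IsManifold (𝓡 n) ∞ M]
  {N : Type*} [TopologicalSpace N] [ChartedSpace (EuclideanSpace ℝ (Fin m)) N]
  [IsManifold (𝓡 m) ∞ N]

theorem pullback_pullback_of_leftInverse {f : M → N} {g : N → M}
    (hf : ContMDiff (𝓡 n) (𝓡 m) ∞ f) (hg : ContMDiff (𝓡 m) (𝓡 n) ∞ g)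
    (h : Function.LeftInverse g f) (α : Form n p M) : pullback f hf (pullback g hg α) = α := by
  refine Subtype.ext (funext fun x => ?_)
  -- All tangent spaces are the model space, so the form may be moved along an equality of points.
  have h5 : ∀ (z z' : M) (_ : z = z') (w : Fin p → EuclideanSpace ℝ (Fin n)),
      (show EuclideanSpace ℝ (Fin n) [⋀^Fin p]→L[ℝ] ℝ from α.1 z) w =
      (show EuclideanSpace ℝ (Fin n) [⋀^Fin p]→L[ℝ] ℝ from α.1 z') w := by
    rintro z _ rfl w
    rfl
  have h1 : mfderiv (𝓡 n) (𝓡 n) (g ∘ f) x =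
      (mfderiv (𝓡 m) (𝓡 n) g (f x)).comp (mfderiv (𝓡 n) (𝓡 m) f x) :=
    mfderiv_comp x ((hg _).mdifferentiableAt (by simp)) ((hf _).mdifferentiableAt (by simp))
  have h2 : g ∘ f = id := funext h
  rw [h2, mfderiv_id] at h1
  ext v
  refine Eq.trans ?_ (h5 _ _ (h x) v)
  refine congrArg (show EuclideanSpace ℝ (Fin n) [⋀^Fin p]→L[ℝ] ℝ from α.1 (g (f x))) ?_
  funext i
  exact (DFunLike.congr_fun h1 (v i)).symm

theorem cohomologyPullback_mk {f : M → N} (hf : ContMDiff (𝓡 n) (𝓡 m) ∞ f)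
    (α : closedForms m p N) :
    cohomologyPullback f hf (Submodule.Quotient.mk α : Cohomology m p N) =
      Submodule.Quotient.mk (closedPullback f hf α) := rfl

theorem cohomologyPullback_of_leftInverse {f : M → N} {g : N → M}
    (hf : ContMDiff (𝓡 n) (𝓡 m) ∞ f) (hg : ContMDiff (𝓡 m) (𝓡 n) ∞ g)
    (h : Function.LeftInverse g f) (a : Cohomology n p M) :
    cohomologyPullback f hf (cohomologyPullback g hg a) = a := by
  obtain ⟨α, rfl⟩ := Submodule.Quotient.mk_surjective _ a
  rw [cohomologyPullback_mk, cohomologyPullback_mk]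
  congr 1
  exact Subtype.ext (pullback_pullback_of_leftInverse hf hg h α.1)

/-- A diffeomorphism induces an isomorphism in de Rham cohomology. -/
def cohomologyEquiv (φ : M ≃ₘ^∞⟮𝓡 n, 𝓡 m⟯ N) : Cohomology m p N ≃ₗ[ℝ] Cohomology n p M :=
  { cohomologyPullback φ φ.contMDiff with
    invFun := cohomologyPullback φ.symm φ.symm.contMDiff
    left_inv := cohomologyPullback_of_leftInverse _ _ φ.apply_symm_apply
    right_inv := cohomologyPullback_of_leftInverse _ _ φ.symm_apply_apply }

end Functoriality

/-! ### The signature form -/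

section SignatureForm

variable {k : ℕ} {M : Type*} [TopologicalSpace M] [T2Space M] [CompactSpace M]
  [ChartedSpace (EuclideanSpace ℝ (Fin (4 * k))) M] [IsManifold (𝓡 (4 * k)) ∞ M]

theorem integral_wedge_comm (o : ManifoldOrientation (4 * k) M) (α β : Form (4 * k) (2 * k) M) :
    integral o (wedge (two_mul_add_two_mul k) α β) =
      integral o (wedge (two_mul_add_two_mul k) β α) := by
  rw [wedge_comm_of_even (even_two_mul k)]

theorem integral_wedge_add_left (o : ManifoldOrientation (4 * k) M)
    (α α' β : Form (4 * k) (2 * k) M) :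
    integral o (wedge (two_mul_add_two_mul k) (α + α') β) =
      integral o (wedge (two_mul_add_two_mul k) α β) +
        integral o (wedge (two_mul_add_two_mul k) α' β) := by
  rw [wedge_add_left, integral_add]

/-- The integral of `α ∧ β` for closed `α` and `β` only depends on the class of `α`. -/
theorem integral_wedge_congr_left (o : ManifoldOrientation (4 * k) M)
    {α α' : closedForms (4 * k) (2 * k) M}
    (h : (Submodule.Quotient.mk α : Cohomology (4 * k) (2 * k) M) = Submodule.Quotient.mk α')
    (β : closedForms (4 * k) (2 * k) M) :
    integral o (wedge (two_mul_add_two_mul k) α.1 β.1) =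
      integral o (wedge (two_mul_add_two_mul k) α'.1 β.1) := by
  have h1 : α.1 - α'.1 ∈ exactForms (4 * k) M (2 * k) :=
    (Submodule.Quotient.eq
      ((exactForms (4 * k) M (2 * k)).submoduleOf (closedForms (4 * k) (2 * k) M))).1 h
  have h2 := integral_wedge_add_left o (α.1 - α'.1) α'.1 β.1
  rwa [sub_add_cancel, integral_wedge_eq_zero_of_exact o _ h1 β.2, zero_add] at h2

/-- The signature form does not depend on the choice of closed representatives. -/
theorem signatureForm_mk (o : ManifoldOrientation (4 * k) M)
    (α β : closedForms (4 * k) (2 * k) M) :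
    signatureForm o (Submodule.Quotient.mk α) (Submodule.Quotient.mk β) =
      integral o (wedge (two_mul_add_two_mul k) α.1 β.1) := by
  have hout : ∀ a : Cohomology (4 * k) (2 * k) M,
      (Submodule.Quotient.mk a.out : Cohomology (4 * k) (2 * k) M) = a := fun a => a.out_eq'
  rw [signatureForm, integral_wedge_congr_left o (hout (Submodule.Quotient.mk α)),
    integral_wedge_comm, integral_wedge_congr_left o (hout (Submodule.Quotient.mk β)),
    integral_wedge_comm]

theorem signatureForm_comm (o : ManifoldOrientation (4 * k) M)
    (a b : Cohomology (4 * k) (2 * k) M) : signatureForm o a b = signatureForm o b a :=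
  integral_wedge_comm o _ _

theorem signatureForm_add_left (o : ManifoldOrientation (4 * k) M)
    (a a' b : Cohomology (4 * k) (2 * k) M) :
    signatureForm o (a + a') b = signatureForm o a b + signatureForm o a' b := by
  obtain ⟨α, rfl⟩ := Submodule.Quotient.mk_surjective _ a
  obtain ⟨α', rfl⟩ := Submodule.Quotient.mk_surjective _ a'
  obtain ⟨β, rfl⟩ := Submodule.Quotient.mk_surjective _ b
  rw [← Submodule.Quotient.mk_add, signatureForm_mk, signatureForm_mk, signatureForm_mk]
  exact integral_wedge_add_left o α.1 α'.1 β.1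

theorem signatureForm_smul_left (o : ManifoldOrientation (4 * k) M) (t : ℝ)
    (a b : Cohomology (4 * k) (2 * k) M) :
    signatureForm o (t • a) b = t * signatureForm o a b := by
  obtain ⟨α, rfl⟩ := Submodule.Quotient.mk_surjective _ a
  obtain ⟨β, rfl⟩ := Submodule.Quotient.mk_surjective _ b
  rw [← Submodule.Quotient.mk_smul, signatureForm_mk, signatureForm_mk, ← integral_smul,
    ← wedge_smul_left]
  rfl

/-- The signature form as a bilinear form. -/
def signatureBilin (o : ManifoldOrientation (4 * k) M) :
    LinearMap.BilinForm ℝ (Cohomology (4 * k) (2 * k) M) :=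
  LinearMap.mk₂ ℝ (signatureForm o) (signatureForm_add_left o) (signatureForm_smul_left o)
    (fun a b b' => by
      rw [signatureForm_comm, signatureForm_add_left, signatureForm_comm o b,
        signatureForm_comm o b'])
    (fun t a b => by
      rw [signatureForm_comm, signatureForm_smul_left, signatureForm_comm o b]; rfl)

/-- The signature may be computed in any basis; a finite basis forces finite dimension, so the
default value `0` in the definition of `signature` plays no role. -/
theorem matrixSignature_signatureFormMatrix (o : ManifoldOrientation (4 * k) M) {s : ℕ}
    (b : Module.Basis (Fin s) ℝ (Cohomology (4 * k) (2 * k) M)) :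
    matrixSignature (signatureFormMatrix o b) = signature o := by
  have hfin : Module.Finite ℝ (Cohomology (4 * k) (2 * k) M) := Module.Finite.of_basis b
  rw [signature, dif_pos hfin]
  exact (matrixSignature_eq_sigPos_sub_sigNeg (signatureBilin o) (signatureForm_comm o) b).trans
    (matrixSignature_eq_sigPos_sub_sigNeg (signatureBilin o) (signatureForm_comm o) _).symm

variable {N : Type*} [TopologicalSpace N] [T2Space N] [CompactSpace N]
  [ChartedSpace (EuclideanSpace ℝ (Fin (4 * k))) N] [IsManifold (𝓡 (4 * k)) ∞ N]
  {oM : ManifoldOrientation (4 * k) M} {oN : ManifoldOrientation (4 * k) N}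

theorem signatureForm_cohomologyPullback (φ : M ≃ₘ^∞⟮𝓡 (4 * k), 𝓡 (4 * k)⟯ N)
    (hφ : OrientationPreserving oM oN φ) (a b : Cohomology (4 * k) (2 * k) N) :
    signatureForm oM (cohomologyPullback φ φ.contMDiff a) (cohomologyPullback φ φ.contMDiff b) =
      signatureForm oN a b := by
  obtain ⟨α, rfl⟩ := Submodule.Quotient.mk_surjective _ a
  obtain ⟨β, rfl⟩ := Submodule.Quotient.mk_surjective _ b
  rw [cohomologyPullback_mk, cohomologyPullback_mk, signatureForm_mk, signatureForm_mk,
    ← integral_pullback φ hφ, ← wedge_pullback]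
  rfl

/-- The image of a basis of `H^{2k}(N)` is a basis of `H^{2k}(M)` with the same matrix. -/
theorem signature_eq_of_diffeomorph (φ : M ≃ₘ^∞⟮𝓡 (4 * k), 𝓡 (4 * k)⟯ N)
    (hφ : OrientationPreserving oM oN φ) : signature oM = signature oN := by
  by_cases hN : Module.Finite ℝ (Cohomology (4 * k) (2 * k) N)
  · let b := Module.finBasis ℝ (Cohomology (4 * k) (2 * k) N)
    rw [← matrixSignature_signatureFormMatrix oN b,
      ← matrixSignature_signatureFormMatrix oM (b.map (cohomologyEquiv φ))]
    congr 1
    ext i j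
    simp only [signatureFormMatrix, Matrix.of_apply, Module.Basis.map_apply]
    exact signatureForm_cohomologyPullback φ hφ (b i) (b j)
  · have hM : ¬ Module.Finite ℝ (Cohomology (4 * k) (2 * k) M) := fun _ =>
      hN (Module.Finite.equiv (cohomologyEquiv φ).symm)
    rw [signature, signature, dif_neg hM, dif_neg hN]

end SignatureForm

end DeRham

end

theorem mainTheorem3 (k : ℕ)
    {M : Type*} [TopologicalSpace M] [T2Space M] [CompactSpace M]
    [ChartedSpace (EuclideanSpace ℝ (Fin (4 * k))) M] [IsManifold (𝓡 (4 * k)) ∞ M]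
    {N : Type*} [TopologicalSpace N] [T2Space N] [CompactSpace N]
    [ChartedSpace (EuclideanSpace ℝ (Fin (4 * k))) N] [IsManifold (𝓡 (4 * k)) ∞ N]
    (oM : ManifoldOrientation (4 * k) M) (oN : ManifoldOrientation (4 * k) N)
    (φ : M ≃ₘ^∞⟮𝓡 (4 * k), 𝓡 (4 * k)⟯ N) (hφ : OrientationPreserving oM oN φ) :
    -- `Q_M` and `Q_N` are given by the integral formula, whatever the representatives
    ((∀ α β : closedForms (4 * k) (2 * k) M,
        signatureForm oM (Submodule.Quotient.mk α) (Submodule.Quotient.mk β) =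
          integral oM (wedge (two_mul_add_two_mul k) α.1 β.1)) ∧
      (∀ α β : closedForms (4 * k) (2 * k) N,
        signatureForm oN (Submodule.Quotient.mk α) (Submodule.Quotient.mk β) =
          integral oN (wedge (two_mul_add_two_mul k) α.1 β.1))) ∧
    -- invariance of the signature form
    (∀ a b : Cohomology (4 * k) (2 * k) N,
      signatureForm oM (cohomologyPullback φ φ.contMDiff a) (cohomologyPullback φ φ.contMDiff b) =
        signatureForm oN a b) ∧
    -- the signature can be computed in any basis
    ((∀ (s : ℕ) (b : Module.Basis (Fin s) ℝ (Cohomology (4 * k) (2 * k) M)),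
        matrixSignature (signatureFormMatrix oM b) = signature oM) ∧
      (∀ (s : ℕ) (b : Module.Basis (Fin s) ℝ (Cohomology (4 * k) (2 * k) N)),
        matrixSignature (signatureFormMatrix oN b) = signature oN)) ∧
    -- invariance of the signature
    signature oM = signature oN := by
  exact ⟨⟨signatureForm_mk oM, signatureForm_mk oN⟩, signatureForm_cohomologyPullback φ hφ,
    ⟨fun _ b => matrixSignature_signatureFormMatrix oM b,
      fun _ b => matrixSignature_signatureFormMatrix oN b⟩,
    signature_eq_of_diffeomorph φ hφ⟩
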